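/- Let $a<b$, let $n\ge 1$, $h=(b-a)/n$, and let $x_i=a+ih$ for $0\le i\le n$, $x_i=a$ for $i<0$, $x_i=b$ for $i>n$. For $d\ge 1$ and $1\le j\le n+d$ let $B_j$ be the normalized B-spline of degree $d$ with support $[x_{j-d-1},x_j]$ on these knots (these B-splines sum to $1$ on $[a,b]$), and let $t_j=\frac12(x_{j-2}+x_{j-1})$, $1\le j\le n+2$. For $f:[a,b]\to\mathbb R$ put $Q_df=\sum_{j=1}^{n+d}\mu_j(f)B_j$, $2\le d\le 5$, where $f_j=f(t_j)$ if $d$ is even, $f_j=f(x_j)$ if $d$ is odd, and the coefficients are as follows. * $d=2$: $\mu_1=f_1$, $\mu_2=\frac16(-2f_1+9f_2-f_3)$, and $\mu_j=\frac18(-f_{j-1}+10f_j-f_{j+1})$ for $3\le j\le n$. * $d=3$: $\mu_1=f_0$, $\mu_2=\frac1{18}(7f_0+18f_1-9f_2+2f_3)$, and $\mu_j=\frac16(-f_{j-3}+8f_{j-2}-f_{j-1})$ for $3\le j\le n+1$. * $d=4$: $\mu_1=f_1$, $\mu_2=\frac{17}{105}f_1+\frac{35}{32}f_2-\frac{35}{96}f_3+\frac{21}{160}f_4-\frac5{224}f_5$,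 $\mu_3=-\frac{19}{45}f_1+\frac{377}{288}f_2+\frac{61}{288}f_3-\frac{59}{480}f_4+\frac7{288}f_5$, $\mu_4=\frac{47}{315}f_1-\frac{77}{144}f_2+\frac{251}{144}f_3-\frac{97}{240}f_4+\frac{47}{1008}f_5$, and $\mu_j=\frac{47}{1152}(f_{j-3}+f_{j+1})-\frac{107}{288}(f_{j-2}+f_j)+\frac{319}{192}f_{j-1}$ for $5\le j\le n$. * $d=5$: $\mu_1=f_0$, $\mu_2=\frac{163}{300}f_0+f_1-f_2+\frac23f_3-\frac14f_4+\frac1{25}f_5$, $\mu_3=\frac1{200}f_0+\frac{103}{60}f_1-\frac{73}{60}f_2+\frac7{10}f_3-\frac{29}{120}f_4+\frac{11}{300}f_5$, $\mu_4=-\frac{41}{400}f_0+\frac{43}{60}f_1+\frac{103}{120}f_2-\frac7{10}f_3+\frac{13}{48}f_4-\frac{13}{300}f_5$, and $\mu_j=\frac{13}{240}(f_{j-5}+f_{j-1})-\frac7{15}(f_{j-4}+f_{j-2})+\frac{73}{40}f_{j-3}$ for $5\le j\le n+1$. The remaining coefficients, at the right end, are given by the mirror formulas: $\mu_{n+d+1-j}$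 is obtained from $\mu_j$ by replacing $f_i$ with $f_{n+3-i}$ if $d$ is even and with $f_{n-i}$ if $d$ is odd. Let $\mathcal I(f)=\int_a^bf$ and $\mathcal I_d(f)=\int_a^bQ_df$; for even $n$ let $\mathcal I_2^*(f)=\frac h3\sum_{k=0}^{n/2-1}\bigl(f(x_{2k})+4f(x_{2k+1})+f(x_{2k+2})\bigr)$ be the composite Simpson rule. Then the following hold. **(1) Quadrature rules.** For every function $f$, with empty sums equal to $0$ (and $Q_df$ is integrable on $[a,b]$): * for $n\ge4$, $\mathcal I_2(f)=h\sum_{j=4}^{n-1}f_j+h\left[\frac19(f_1+f_{n+2})+\frac78(f_2+f_{n+1})+\frac{73}{72}(f_3+f_n)\right]$; * for $n\ge7$, $\mathcal I_3(f)=h\sum_{j=4}^{n-4}f_j+h\left[\frac{23}{72}(f_0+f_n)+\frac43(f_1+f_{n-1})+\frac{19}{24}(f_2+f_{n-2})+\frac{19}{18}(f_3+f_{n-3})\right]$; * for $n\ge8$, $\mathcal I_4(f)=h\sum_{j=6}^{n-3}f_j+h\left[\frac{206}{1575}(f_1+f_{n+2})+\frac{107}{128}(f_2+f_{n+1})+\frac{6019}{5760}(f_3+f_n)+\frac{9467}{9600}(f_4+f_{n-1})+\frac{13469}{13440}(f_5+f_{n-2})\right]$;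 * for $n\ge11$, $\mathcal I_5(f)=h\sum_{j=6}^{n-6}f_j+h\left[\frac{157}{480}(f_0+f_n)+\frac{961}{720}(f_1+f_{n-1})+\frac{133}{180}(f_2+f_{n-2})+\frac{271}{240}(f_3+f_{n-3})+\frac{1393}{1440}(f_4+f_{n-4})+\frac{361}{360}(f_5+f_{n-5})\right]$. **(2) Errors.** Let $n_2=4$, $n_3=7$, $n_4=8$, $n_5=11$. For $2\le d\le5$ and $f\in C^{d+1}([a,b])$ there is a constant $C$ (independent of $n$) with $|\mathcal I(f)-\mathcal I_d(f)|\le C\,h^{d+1}$ for all $n\ge n_d$. Moreover: * for $f\in C^4([a,b])$ and $n\ge4$ there are $c,\bar c\in[a,b]$ with $\mathcal I(f)-\mathcal I_2(f)=\frac{23}{5760}(b-a)h^4f^{(4)}(c)-\frac1{192}h^5f^{(4)}(\bar c)$; * for $f\in C^6([a,b])$ there is a constant $C$ with $|\mathcal I(f)-\mathcal I_4(f)|\le C\,h^6$ for all $n\ge8$. **(3) Extrapolation.** For $f\in C^4([a,b])$ and even $n\ge2$ there is $c\in[a,b]$ with $\mathcal I(f)-\mathcal I_2^*(f)=-\frac1{180}(b-a)h^4f^{(4)}(c)$.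 For $f\in C^5([a,b])$ there is a constant $C$ with $$\left|\mathcal I(f)-\tfrac1{55}\bigl(32\,\mathcal I_2(f)+23\,\mathcal I_2^*(f)\bigr)\right|\le C\,h^5\qquad\text{for all even }n\ge4 .$$ -/

import Mathlib

open MeasureTheory

noncomputable section

namespace SplineQI

/-- The meshlength `h = (b - a) / n` of the uniform partition of `[a, b]` into `n` subintervals. -/
def mesh (a b : ℝ) (n : ℕ) : ℝ := (b - a) / n

/-- The knots `x_i`: `x_i = a + i h` for `0 ≤ i ≤ n`, with multiple knots
`x_i = a` for `i ≤ 0` and `x_i = b` for `i ≥ n` at the endpoints. -/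
def knot (a b : ℝ) (n : ℕ) (i : ℤ) : ℝ := a + ((max 0 (min i n) : ℤ) : ℝ) * mesh a b n

/-- The points `t_j = (x_{j-2} + x_{j-1}) / 2`, so `t_1 = a`, `t_{n+2} = b`, and the other
`t_j` are the midpoints of the subintervals. -/
def midpt (a b : ℝ) (n : ℕ) (j : ℤ) : ℝ := (knot a b n (j - 2) + knot a b n (j - 1)) / 2

/-- The normalized B-spline `B_j` of degree `d` with support `[x_{j-d-1}, x_j]`, by the
Cox-de Boor recursion (a quotient with zero denominator is `0`, as usual).
The last subinterval is closed at `b`. -/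
def bspline (a b : ℝ) (n : ℕ) : ℕ → ℤ → ℝ → ℝ
  | 0, j, x =>
      if (knot a b n (j - 1) ≤ x ∧ x < knot a b n j) ∨ (j = n ∧ x = b) then 1 else 0
  | d + 1, j, x =>
      (x - knot a b n (j - d - 2)) / (knot a b n (j - 1) - knot a b n (j - d - 2))
          * bspline a b n d (j - 1) x
        + (knot a b n j - x) / (knot a b n j - knot a b n (j - d - 1))
          * bspline a b n d j x

/-- The spline `∑_{j = 1}^{n + d} c_j B_j` of degree `d`. -/
def spline (a b : ℝ) (n d : ℕ) (c : ℤ → ℝ) (x : ℝ) : ℝ :=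
  ∑ j ∈ Finset.Icc (1 : ℤ) (n + d), c j * bspline a b n d j x

/-- Coefficient functionals of the quadratic quasi-interpolant; `y j = f (t_j)`. -/
def mu2 (n : ℕ) (y : ℤ → ℝ) (j : ℤ) : ℝ :=
  if j = 1 then y 1
  else if j = 2 then (1 / 6) * (-2 * y 1 + 9 * y 2 - y 3)
  else if j = n + 1 then (1 / 6) * (-y n + 9 * y (n + 1) - 2 * y (n + 2))
  else if j = n + 2 then y (n + 2)
  else (1 / 8) * (-y (j - 1) + 10 * y j - y (j + 1))

/-- Coefficient functionals of the cubic quasi-interpolant; `y j = f (x_j)`. -/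
def mu3 (n : ℕ) (y : ℤ → ℝ) (j : ℤ) : ℝ :=
  if j = 1 then y 0
  else if j = 2 then (1 / 18) * (7 * y 0 + 18 * y 1 - 9 * y 2 + 2 * y 3)
  else if j = n + 2 then
    (1 / 18) * (2 * y (n - 3) - 9 * y (n - 2) + 18 * y (n - 1) + 7 * y n)
  else if j = n + 3 then y n
  else (1 / 6) * (-y (j - 3) + 8 * y (j - 2) - y (j - 1))

/-- Coefficient functionals of the quartic quasi-interpolant; `y j = f (t_j)`. -/
def mu4 (n : ℕ) (y : ℤ → ℝ) (j : ℤ) : ℝ :=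
  if j = 1 then y 1
  else if j = 2 then
    17 / 105 * y 1 + 35 / 32 * y 2 - 35 / 96 * y 3 + 21 / 160 * y 4 - 5 / 224 * y 5
  else if j = 3 then
    -(19 / 45) * y 1 + 377 / 288 * y 2 + 61 / 288 * y 3 - 59 / 480 * y 4 + 7 / 288 * y 5
  else if j = 4 then
    47 / 315 * y 1 - 77 / 144 * y 2 + 251 / 144 * y 3 - 97 / 240 * y 4 + 47 / 1008 * y 5
  else if j = n + 1 then
    47 / 315 * y (n + 2) - 77 / 144 * y (n + 1) + 251 / 144 * y n - 97 / 240 * y (n - 1)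
      + 47 / 1008 * y (n - 2)
  else if j = n + 2 then
    -(19 / 45) * y (n + 2) + 377 / 288 * y (n + 1) + 61 / 288 * y n - 59 / 480 * y (n - 1)
      + 7 / 288 * y (n - 2)
  else if j = n + 3 then
    17 / 105 * y (n + 2) + 35 / 32 * y (n + 1) - 35 / 96 * y n + 21 / 160 * y (n - 1)
      - 5 / 224 * y (n - 2)
  else if j = n + 4 then y (n + 2)
  else
    47 / 1152 * (y (j - 3) + y (j + 1)) - 107 / 288 * (y (j - 2) + y j) + 319 / 192 * y (j - 1)

/-- Coefficient functionals of the quintic quasi-interpolant; `y j = f (x_j)`. -/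
def mu5 (n : ℕ) (y : ℤ → ℝ) (j : ℤ) : ℝ :=
  if j = 1 then y 0
  else if j = 2 then
    163 / 300 * y 0 + y 1 - y 2 + 2 / 3 * y 3 - 1 / 4 * y 4 + 1 / 25 * y 5
  else if j = 3 then
    1 / 200 * y 0 + 103 / 60 * y 1 - 73 / 60 * y 2 + 7 / 10 * y 3 - 29 / 120 * y 4
      + 11 / 300 * y 5
  else if j = 4 then
    -(41 / 400) * y 0 + 43 / 60 * y 1 + 103 / 120 * y 2 - 7 / 10 * y 3 + 13 / 48 * y 4
      - 13 / 300 * y 5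
  else if j = n + 2 then
    -(41 / 400) * y n + 43 / 60 * y (n - 1) + 103 / 120 * y (n - 2) - 7 / 10 * y (n - 3)
      + 13 / 48 * y (n - 4) - 13 / 300 * y (n - 5)
  else if j = n + 3 then
    1 / 200 * y n + 103 / 60 * y (n - 1) - 73 / 60 * y (n - 2) + 7 / 10 * y (n - 3)
      - 29 / 120 * y (n - 4) + 11 / 300 * y (n - 5)
  else if j = n + 4 then
    163 / 300 * y n + y (n - 1) - y (n - 2) + 2 / 3 * y (n - 3) - 1 / 4 * y (n - 4)
      + 1 / 25 * y (n - 5)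
  else if j = n + 5 then y n
  else
    13 / 240 * (y (j - 5) + y (j - 1)) - 7 / 15 * (y (j - 4) + y (j - 2)) + 73 / 40 * y (j - 3)

/-- The `C^1` quadratic quasi-interpolant `Q_2 f`. -/
def Q2 (a b : ℝ) (n : ℕ) (f : ℝ → ℝ) : ℝ → ℝ :=
  spline a b n 2 (mu2 n fun j => f (midpt a b n j))

/-- The `C^2` cubic quasi-interpolant `Q_3 f`. -/
def Q3 (a b : ℝ) (n : ℕ) (f : ℝ → ℝ) : ℝ → ℝ :=
  spline a b n 3 (mu3 n fun j => f (knot a b n j))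

/-- The `C^3` quartic quasi-interpolant `Q_4 f`. -/
def Q4 (a b : ℝ) (n : ℕ) (f : ℝ → ℝ) : ℝ → ℝ :=
  spline a b n 4 (mu4 n fun j => f (midpt a b n j))

/-- The `C^4` quintic quasi-interpolant `Q_5 f`. -/
def Q5 (a b : ℝ) (n : ℕ) (f : ℝ → ℝ) : ℝ → ℝ :=
  spline a b n 5 (mu5 n fun j => f (knot a b n j))

/-- The quadrature formula `I_2(f) = ∫_a^b Q_2 f`. -/
def I2 (a b : ℝ) (n : ℕ) (f : ℝ → ℝ) : ℝ := ∫ x in a..b, Q2 a b n f x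

/-- The quadrature formula `I_3(f) = ∫_a^b Q_3 f`. -/
def I3 (a b : ℝ) (n : ℕ) (f : ℝ → ℝ) : ℝ := ∫ x in a..b, Q3 a b n f x

/-- The quadrature formula `I_4(f) = ∫_a^b Q_4 f`. -/
def I4 (a b : ℝ) (n : ℕ) (f : ℝ → ℝ) : ℝ := ∫ x in a..b, Q4 a b n f x

/-- The quadrature formula `I_5(f) = ∫_a^b Q_5 f`. -/
def I5 (a b : ℝ) (n : ℕ) (f : ℝ → ℝ) : ℝ := ∫ x in a..b, Q5 a b n f x

/-- The composite Simpson rule on the knots `x_0, …, x_n`, for even `n`. -/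
def simpson (a b : ℝ) (n : ℕ) (f : ℝ → ℝ) : ℝ :=
  mesh a b n / 3 * ∑ k ∈ Finset.range (n / 2),
    (f (knot a b n (2 * k)) + 4 * f (knot a b n (2 * k + 1)) + f (knot a b n (2 * k + 2)))

end SplineQI

end

/-! The integral of a B-spline is its support length divided by `d + 1`. This is the zeroth moment
in the formula that expresses `∫ x ^ k B_j` through the complete homogeneous symmetric polynomial of
degree `k` in the `d + 2` knots of `B_j`. All moments enter because the Cox-de Boor recursion
multiplies by linear functions, so an induction on `d` raises `k`. On uniform knots only the `d`
B-splines nearest each end are shorter than `d + 1` cells. The interior coefficient functionals have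
weights of sum one, so summing them gives every inner value the weight `h`, and the remaining
fractions come from the ends. The thresholds `4, 7, 8, 11` are the least `n` for which the
exceptional weights of the two ends do not overlap.

The orders of the errors are read off these explicit rules; polynomial reproduction by the
quasi-interpolants is never used. Each rule is rewritten as a sum of local formulas: overlapping
translates of one interior formula and two mirrored end formulas. By Taylor expansion, a local
formula exact to degree `m` has error `O(h ^ (m + 2))`. There are `O(1 / h)` interior blocks but
only two ends, so exactness to degree `q + 1` inside and `q` at the ends gives `O(h ^ (q + 2))`
(`exists_composite_bound`), with `q = d - 1`. For `d = 4` the same formulas serve with `q = 4`,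
which is the gain of one order.

The error formula for `d = 2` compares the rule with the composite midpoint rule, from which it
differs only at the ends. Correction terms in `g'` and `g'''` at the endpoints split the error into
a midpoint part and a boundary part, both of which vanish on cubics and have nonnegative Peano
kernels. The masses of these kernels are the constants `23 / 5760` and `1 / 192`, and the
intermediate value theorem supplies the two points. Simpson's rule is treated in the same way. The
leading terms `23 / 5760` and `-1 / 180 = -32 / 5760` cancel under the weights `32` and `23`, whose
sum is `55`. -/

noncomputable section

namespace SplineQI

/-! ### Moments of B-splines -/

/-- The complete homogeneous symmetric polynomial of degree `k` in `τ i, …, τ (i + m - 1)`. -/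
def hsymm (τ : ℤ → ℝ) : ℕ → ℕ → ℤ → ℝ
  | 0, _, _ => 1
  | _ + 1, 0, _ => 0
  | k + 1, m + 1, i => hsymm τ (k + 1) m i + τ (i + m) * hsymm τ k (m + 1) i

theorem hsymm_zero (τ : ℤ → ℝ) (m : ℕ) (i : ℤ) : hsymm τ 0 m i = 1 := by
  cases m <;> simp [hsymm]

theorem hsymm_succ_last (τ : ℤ → ℝ) (k m : ℕ) (i : ℤ) :
    hsymm τ (k + 1) (m + 1) i = hsymm τ (k + 1) m i + τ (i + m) * hsymm τ k (m + 1) i := by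
  rw [hsymm]

/-- The definition splits off the last variable. The first variable can be split off as well because
the polynomials are symmetric. In the inductive step both sides are expanded in the last variable,
and the mixed terms agree by the case of lower degree. -/
theorem hsymm_succ_first (τ : ℤ → ℝ) (k m : ℕ) (i : ℤ) :
    hsymm τ (k + 1) (m + 1) i
      = hsymm τ (k + 1) m (i + 1) + τ i * hsymm τ k (m + 1) i := by
  induction k generalizing m i with
  | zero =>
    induction m generalizing i with
    | zero => simp [hsymm]
    | succ m ih =>
      rw [hsymm_succ_last, ih, hsymm_succ_last _ 0 m]
      simp only [hsymm_zero]
      push_cast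
      rw [show i + ((m : ℤ) + 1) = i + 1 + m by ring]
      ring
  | succ k ihk =>
    induction m generalizing i with
    | zero =>
      rw [hsymm_succ_last]
      simp [hsymm]
    | succ m ih =>
      have h1 := hsymm_succ_last τ k (m + 1) i
      have h2 := ihk (m + 1) i
      rw [hsymm_succ_last, ih, hsymm_succ_last _ (k + 1) m (i + 1)]
      push_cast at h1 ⊢
      rw [show i + ((m : ℤ) + 1) = i + 1 + m by ring] at h1 ⊢
      linear_combination τ (i + 1 + m) * h2 - τ i * h1

/-- Removing the first or the last variable of a complete homogeneous symmetric polynomial. -/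
theorem hsymm_sub (τ : ℤ → ℝ) (k m : ℕ) (i : ℤ) :
    hsymm τ (k + 1) m i - hsymm τ (k + 1) m (i + 1)
      = (τ i - τ (i + m)) * hsymm τ k (m + 1) i := by
  have h1 := hsymm_succ_first τ k m i
  have h2 := hsymm_succ_last τ k m i
  linear_combination h1 - h2

/-- The two recursions, multiplied crosswise by the end variables and subtracted, lose their
lower-degree terms. Together with `hsymm_sub` this recombines the two halves of the Cox-de Boor
recursion, whose knot sets differ only at their ends. -/
theorem hsymm_mul_sub (τ : ℤ → ℝ) (k m : ℕ) (i : ℤ) :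
    τ (i + m) * hsymm τ k m (i + 1) - τ i * hsymm τ k m i
      = (τ (i + m) - τ i) * hsymm τ k (m + 1) i := by
  cases k with
  | zero => simp [hsymm_zero]
  | succ k =>
    have h1 := hsymm_succ_first τ k m i
    have h2 := hsymm_succ_last τ k m i
    linear_combination τ i * h2 - τ (i + m) * h1

/-- On `m + 1` equal variables `y`, the complete symmetric polynomials are `C(k + m, k) y ^ k`. -/
theorem hsymm_of_eq (τ : ℤ → ℝ) (y : ℝ) (k m : ℕ) (i : ℤ)
    (h : ∀ r : ℕ, r ≤ m → τ (i + r) = y) :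
    hsymm τ k (m + 1) i = (k + m).choose k * y ^ k := by
  induction k generalizing m with
  | zero => simp [hsymm_zero]
  | succ k ihk =>
    induction m with
    | zero =>
      rw [hsymm_succ_last, ihk 0 h, h 0 le_rfl]
      simp [hsymm, pow_succ']
    | succ m ih =>
      rw [hsymm_succ_last, ih (fun r hr => h r (by omega)), ihk (m + 1) h, h (m + 1) le_rfl]
      rw [show k + 1 + (m + 1) = (k + (m + 1)) + 1 by ring, Nat.choose_succ_succ,
        show k + 1 + m = k + (m + 1) by ring]
      push_cast
      ring

/-! ### Knots of the uniform partition -/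

theorem mesh_pos {a b : ℝ} (hab : a < b) {n : ℕ} (hn : 0 < n) : 0 < mesh a b n := by
  have : (0 : ℝ) < n := by exact_mod_cast hn
  unfold mesh
  exact div_pos (by linarith) this

theorem knot_of_nonpos (a b : ℝ) (n : ℕ) {i : ℤ} (hi : i ≤ 0) : knot a b n i = a := by
  have : max 0 (min i (n : ℤ)) = 0 := by omega
  simp [knot, this]

theorem knot_of_mem (a b : ℝ) (n : ℕ) {i : ℤ} (h0 : 0 ≤ i) (hi : i ≤ n) :
    knot a b n i = a + i * mesh a b n := by
  have : max 0 (min i (n : ℤ)) = i := by omega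
  simp [knot, this]

theorem knot_of_ge (a b : ℝ) {n : ℕ} (hn : 0 < n) {i : ℤ} (hi : (n : ℤ) ≤ i) :
    knot a b n i = b := by
  have h : max 0 (min i (n : ℤ)) = n := by omega
  have : (n : ℝ) ≠ 0 := by exact_mod_cast hn.ne'
  simp only [knot, h, mesh]
  push_cast
  field_simp
  ring

theorem knot_mono {a b : ℝ} (hab : a < b) (n : ℕ) : Monotone (knot a b n) := by
  intro i j hij
  have h : max 0 (min i (n : ℤ)) ≤ max 0 (min j (n : ℤ)) := by omega
  have h' : ((max 0 (min i (n : ℤ)) : ℤ) : ℝ) ≤ ((max 0 (min j (n : ℤ)) : ℤ) : ℝ) := by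
    exact_mod_cast h
  have hm : 0 ≤ mesh a b n := div_nonneg (by linarith) (Nat.cast_nonneg n)
  unfold knot
  gcongr

theorem knot_mem_Icc {a b : ℝ} (hab : a < b) {n : ℕ} (hn : 0 < n) (i : ℤ) :
    knot a b n i ∈ Set.Icc a b := by
  constructor
  · rcases le_total 0 i with h | h
    · exact (knot_of_nonpos a b n le_rfl).ge.trans (knot_mono hab n h)
    · rw [knot_of_nonpos a b n h]
  · rcases le_total i n with h | h
    · exact (knot_mono hab n h).trans (knot_of_ge a b hn le_rfl).le
    · rw [knot_of_ge a b hn h]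

/-! ### Integrals of B-splines through the Cox-de Boor recursion -/

/-- Up to the point `b`, a B-spline of degree `0` is the indicator of a subinterval. -/
theorem bspline_zero_ae {a b : ℝ} (n : ℕ) (j : ℤ) :
    bspline a b n 0 j =ᵐ[volume]
      (Set.Ioc (knot a b n (j - 1)) (knot a b n j)).indicator fun _ => 1 := by
  have h1 : ∀ᵐ x : ℝ, x ≠ b := Measure.ae_ne volume b
  have h2 : ∀ᵐ x : ℝ, x ≠ knot a b n (j - 1) := Measure.ae_ne volume _
  have h3 : ∀ᵐ x : ℝ, x ≠ knot a b n j := Measure.ae_ne volume _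
  filter_upwards [h1, h2, h3] with x hx1 hx2 hx3
  have : ((knot a b n (j - 1) ≤ x ∧ x < knot a b n j) ∨ (j = n ∧ x = b))
      ↔ x ∈ Set.Ioc (knot a b n (j - 1)) (knot a b n j) := by
    constructor
    · rintro (⟨h, h'⟩ | ⟨_, h⟩)
      · exact ⟨lt_of_le_of_ne h (Ne.symm hx2), h'.le⟩
      · exact absurd h hx1
    · rintro ⟨h, h'⟩
      exact Or.inl ⟨h.le, lt_of_le_of_ne h' hx3⟩
  simp only [bspline, Set.indicator, this]

theorem bspline_intervalIntegrable {a b : ℝ} (n d : ℕ) (j : ℤ) :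
    IntervalIntegrable (bspline a b n d j) volume a b := by
  induction d generalizing j with
  | zero =>
    have h : IntervalIntegrable ((Set.Ioc (knot a b n (j - 1)) (knot a b n j)).indicator
        fun _ => (1 : ℝ)) volume a b := by
      have hc : IntervalIntegrable (fun _ : ℝ => (1 : ℝ)) volume a b := intervalIntegrable_const
      rw [intervalIntegrable_iff] at hc ⊢
      exact hc.indicator measurableSet_Ioc
    exact h.congr_ae (ae_restrict_of_ae (bspline_zero_ae n j).symm)
  | succ d ih =>
    have h1 := (ih (j - 1)).continuousOn_mul
      (g := fun x => (x - knot a b n (j - d - 2))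
        / (knot a b n (j - 1) - knot a b n (j - d - 2))) (by fun_prop)
    have h2 := (ih j).continuousOn_mul
      (g := fun x => (knot a b n j - x) / (knot a b n j - knot a b n (j - d - 1))) (by fun_prop)
    exact h1.add h2

theorem pow_mul_bspline_intervalIntegrable {a b : ℝ} (n d k : ℕ) (j : ℤ) :
    IntervalIntegrable (fun x => x ^ k * bspline a b n d j x) volume a b :=
  (bspline_intervalIntegrable n d j).continuousOn_mul (by fun_prop)

/-- This is linearity applied to the recursion, valid for repeated knots too. The linear factors
bring in the moment of order `k + 1`, so a formula for the integral alone could not be proved by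
induction on the degree. -/
theorem integral_pow_mul_bspline_succ {a b : ℝ} (n d k : ℕ) (j : ℤ) :
    ∫ x in a..b, x ^ k * bspline a b n (d + 1) j x =
      ((∫ x in a..b, x ^ (k + 1) * bspline a b n d (j - 1) x)
          - knot a b n (j - d - 2) * ∫ x in a..b, x ^ k * bspline a b n d (j - 1) x)
        / (knot a b n (j - 1) - knot a b n (j - d - 2))
      + (knot a b n j * (∫ x in a..b, x ^ k * bspline a b n d j x)
          - ∫ x in a..b, x ^ (k + 1) * bspline a b n d j x)
        / (knot a b n j - knot a b n (j - d - 1)) := by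
  rw [← intervalIntegral.integral_const_mul, ← intervalIntegral.integral_const_mul,
    ← intervalIntegral.integral_sub, ← intervalIntegral.integral_sub,
    ← intervalIntegral.integral_div, ← intervalIntegral.integral_div,
    ← intervalIntegral.integral_add]
  · refine intervalIntegral.integral_congr fun x _ => ?_
    simp only [bspline]
    ring
  · exact ((pow_mul_bspline_intervalIntegrable n d (k + 1) (j - 1)).sub
      ((pow_mul_bspline_intervalIntegrable n d k (j - 1)).const_mul _)).div_const _
  · exact (((pow_mul_bspline_intervalIntegrable n d k j).const_mul _).sub
      (pow_mul_bspline_intervalIntegrable n d (k + 1) j)).div_const _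
  · exact (pow_mul_bspline_intervalIntegrable n d k j).const_mul _
  · exact pow_mul_bspline_intervalIntegrable n d (k + 1) j
  · exact pow_mul_bspline_intervalIntegrable n d (k + 1) (j - 1)
  · exact (pow_mul_bspline_intervalIntegrable n d k (j - 1)).const_mul _

theorem integral_pow_mul_bspline_zero {a b : ℝ} (hab : a < b) {n : ℕ} (hn : 0 < n) (k : ℕ)
    (j : ℤ) :
    ∫ x in a..b, x ^ k * bspline a b n 0 j x
      = (knot a b n j ^ (k + 1) - knot a b n (j - 1) ^ (k + 1)) / (k + 1) := by
  have hle : knot a b n (j - 1) ≤ knot a b n j := knot_mono hab n (by omega)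
  have h1 := knot_mem_Icc hab hn (j - 1)
  have h2 := knot_mem_Icc hab hn j
  rw [← integral_pow, intervalIntegral.integral_of_le hab.le, intervalIntegral.integral_of_le hle]
  have h : (fun x => x ^ k * bspline a b n 0 j x) =ᵐ[volume.restrict (Set.Ioc a b)]
      (Set.Ioc (knot a b n (j - 1)) (knot a b n j)).indicator fun x => x ^ k := by
    refine ae_restrict_of_ae ?_
    filter_upwards [bspline_zero_ae (a := a) (b := b) n j] with x hx
    rw [hx]
    simp [Set.indicator]
  rw [integral_congr_ae h, integral_indicator measurableSet_Ioc,
    Measure.restrict_restrict measurableSet_Ioc,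
    Set.inter_eq_left.2 (Set.Ioc_subset_Ioc h1.1 h2.2)]

/-- Each term of the recursion loses its denominator against the support length in the induction
hypothesis. What remains are symmetric polynomials in the first and in the last `d + 2` of the `d +
3` knots, and `hsymm_sub` and `hsymm_mul_sub` turn their combinations into multiples of the
polynomial in all `d + 3` knots. -/
theorem integral_pow_mul_bspline {a b : ℝ} (hab : a < b) {n : ℕ} (hn : 0 < n) (d k : ℕ)
    (j : ℤ) :
    ∫ x in a..b, x ^ k * bspline a b n d j x
      = (knot a b n j - knot a b n (j - d - 1)) * hsymm (knot a b n) k (d + 2) (j - d - 1)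
        / ((d + 1) * (k + d + 1).choose k) := by
  induction d generalizing k j with
  | zero =>
    rw [integral_pow_mul_bspline_zero hab hn]
    -- In one variable the symmetric polynomial of degree `k + 1` is the power, so `hsymm_sub` is
    -- the factorization of a difference of powers.
    have key : knot a b n j ^ (k + 1) - knot a b n (j - 1) ^ (k + 1)
        = (knot a b n j - knot a b n (j - 1)) * hsymm (knot a b n) k 2 (j - 1) := by
      have h := hsymm_sub (knot a b n) k 1 (j - 1)
      rw [hsymm_of_eq _ (knot a b n (j - 1)) (k + 1) 0 (j - 1) (by simp),
        hsymm_of_eq _ (knot a b n j) (k + 1) 0 (j - 1 + 1) (by simp)] at h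
      simp only [add_zero, Nat.choose_self, Nat.cast_one, one_mul, sub_add_cancel] at h
      linear_combination -h
    rw [key]
    simp
  | succ d ih =>
    set τ := knot a b n with hτ
    have hmono : Monotone τ := knot_mono hab n
    -- a quotient with zero denominator may be cancelled: the numerator vanishes as well
    have cancel : ∀ (i : ℤ) (y : ℝ), y = τ (i - d - 1) ∨ y = τ i →
        (((τ i - τ (i - d - 1)) * hsymm τ (k + 1) (d + 2) (i - d - 1)
            / ((d + 1) * (k + 1 + d + 1).choose (k + 1))
          - y * ((τ i - τ (i - d - 1)) * hsymm τ k (d + 2) (i - d - 1)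
            / ((d + 1) * (k + d + 1).choose k))) / (τ i - τ (i - d - 1)))
        = hsymm τ (k + 1) (d + 2) (i - d - 1) / ((d + 1) * (k + 1 + d + 1).choose (k + 1))
          - y * (hsymm τ k (d + 2) (i - d - 1) / ((d + 1) * (k + d + 1).choose k)) := by
      intro i y hy
      by_cases h : τ i - τ (i - d - 1) = 0
      -- If the outer knots coincide, so do all `d + 2` knots. The left side is a division by zero,
      -- hence `0`. On the right the binomials normalize the symmetric polynomials to powers of `y`,
      -- which leaves `y ^ (k + 1) - y * y ^ k = 0`.
      · have hall : ∀ r : ℕ, r ≤ d + 1 → τ (i - d - 1 + r) = y := by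
          intro r hr
          have h1 : τ (i - d - 1) ≤ τ (i - d - 1 + r) := hmono (by omega)
          have h2 : τ (i - d - 1 + r) ≤ τ i := hmono (by omega)
          rcases hy with rfl | rfl <;> linarith
        rw [hsymm_of_eq τ y (k + 1) (d + 1) _ hall, hsymm_of_eq τ y k (d + 1) _ hall, h]
        have e1 : k + 1 + d + 1 = k + 1 + (d + 1) := by ring
        have e2 : k + d + 1 = k + (d + 1) := by ring
        rw [e1, e2]
        have c1 : ((k + 1 + (d + 1)).choose (k + 1) : ℝ) ≠ 0 := by
          exact_mod_cast (Nat.choose_pos (by omega)).ne'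
        have c2 : ((k + (d + 1)).choose k : ℝ) ≠ 0 := by
          exact_mod_cast (Nat.choose_pos (by omega)).ne'
        have c3 : (d + 1 : ℝ) ≠ 0 := by positivity
        field_simp
        ring
      · field_simp
    rw [integral_pow_mul_bspline_succ, ih, ih, ih, ih, ← hτ]
    have e1 : j - (d : ℤ) - 2 = j - 1 - d - 1 := by ring
    have e2 : j - ((d + 1 : ℕ) : ℤ) - 1 = j - 1 - d - 1 := by push_cast; ring
    have C1 := cancel (j - 1) (τ (j - 1 - d - 1)) (Or.inl rfl)
    have C2 := cancel j (τ j) (Or.inr rfl)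
    rw [e1, e2, C1]
    have C2' := congrArg Neg.neg C2
    rw [← neg_div, neg_sub, neg_sub] at C2'
    rw [C2']
    have s1 := hsymm_sub τ k (d + 2) (j - 1 - d - 1)
    have s2 := hsymm_mul_sub τ k (d + 2) (j - 1 - d - 1)
    have e3 : j - 1 - (d : ℤ) - 1 + 1 = j - d - 1 := by ring
    have e4 : j - 1 - (d : ℤ) - 1 + ((d + 2 : ℕ) : ℤ) = j := by push_cast; ring
    rw [e3, e4] at s1 s2
    -- Both binomials are written as multiples of `C(k + d + 1, k)`. The coefficient of the full
    -- symmetric polynomial is then `1 / (d + 1) * (1 - (k + 1) / (k + d + 2)) = 1 / (k + d + 2)`,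
    -- up to that binomial.
    have q1 : ((k + 1 + d + 1).choose (k + 1) : ℝ) * (k + 1)
        = (k + d + 1).choose k * (k + d + 2) := by
      have := Nat.add_one_mul_choose_eq (k + d + 1) k
      rw [show k + 1 + d + 1 = k + d + 1 + 1 by ring]
      have h' : (((k + d + 1 + 1) * (k + d + 1).choose k : ℕ) : ℝ)
          = (((k + d + 1 + 1).choose (k + 1) * (k + 1) : ℕ) : ℝ) := by rw [this]
      push_cast at h'
      linarith
    have q2 : ((k + (d + 1) + 1).choose k : ℝ) * (d + 2)
        = (k + d + 1).choose k * (k + d + 2) := by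
      have := Nat.choose_mul_succ_eq (k + d + 1) k
      rw [show k + d + 1 + 1 - k = d + 2 by omega] at this
      rw [show k + (d + 1) + 1 = k + d + 1 + 1 by ring]
      have h' : (((k + d + 1).choose k * (k + d + 1 + 1) : ℕ) : ℝ)
          = (((k + d + 1 + 1).choose k * (d + 2) : ℕ) : ℝ) := by rw [this]
      push_cast at h'
      linarith
    have c0 : ((k + d + 1).choose k : ℝ) ≠ 0 := by
      exact_mod_cast (Nat.choose_pos (by omega)).ne'
    have r1 : ((k + 1 + d + 1).choose (k + 1) : ℝ)
        = (k + d + 1).choose k * (k + d + 2) / (k + 1) := by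
      rw [← q1]; field_simp
    have r2 : ((k + (d + 1) + 1).choose k : ℝ)
        = (k + d + 1).choose k * (k + d + 2) / (d + 2) := by
      rw [← q2]; field_simp
    rw [r1, r2]
    push_cast
    set A := hsymm τ (k + 1) (d + 2) (j - 1 - d - 1)
    set B := hsymm τ (k + 1) (d + 2) (j - d - 1)
    set A' := hsymm τ k (d + 2) (j - 1 - d - 1)
    set B' := hsymm τ k (d + 2) (j - d - 1)
    set H := hsymm τ k (d + 1 + 2) (j - 1 - d - 1)
    have s1' : A = B + (τ (j - 1 - d - 1) - τ j) * H := by linarith [s1]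
    have s2' : τ j * B' = τ (j - 1 - d - 1) * A' + (τ j - τ (j - 1 - d - 1)) * H := by
      linarith [s2]
    have c1 : (d + 1 : ℝ) ≠ 0 := by positivity
    have c2 : (d + 1 + 1 : ℝ) ≠ 0 := by positivity
    have c3 : (d + 2 : ℝ) ≠ 0 := by positivity
    have c4 : (k + d + 2 : ℝ) ≠ 0 := by positivity
    rw [s1', ← mul_div_assoc (τ j), s2']
    field_simp
    ring

theorem integral_bspline {a b : ℝ} (hab : a < b) {n : ℕ} (hn : 0 < n) (d : ℕ) (j : ℤ) :
    ∫ x in a..b, bspline a b n d j x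
      = (knot a b n j - knot a b n (j - d - 1)) / (d + 1) := by
  have h := integral_pow_mul_bspline hab hn d 0 j
  simpa [hsymm_zero] using h

theorem spline_intervalIntegrable {a b : ℝ} (n d : ℕ) (c : ℤ → ℝ) :
    IntervalIntegrable (spline a b n d c) volume a b := by
  have h := IntervalIntegrable.sum (μ := volume) (a := a) (b := b) (Finset.Icc (1 : ℤ) (n + d))
    (f := fun j x => c j * bspline a b n d j x)
    fun j _ => (bspline_intervalIntegrable n d j).const_mul (c j)
  have e : spline a b n d c
      = ∑ j ∈ Finset.Icc (1 : ℤ) (n + d), fun x => c j * bspline a b n d j x := by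
    funext x
    simp [spline]
  rwa [e]

theorem integral_spline {a b : ℝ} (hab : a < b) {n : ℕ} (hn : 0 < n) (d : ℕ) (c : ℤ → ℝ) :
    ∫ x in a..b, spline a b n d c x
      = ∑ j ∈ Finset.Icc (1 : ℤ) (n + d),
          c j * ((knot a b n j - knot a b n (j - d - 1)) / (d + 1)) := by
  unfold spline
  rw [intervalIntegral.integral_finsetSum
    fun j _ => (bspline_intervalIntegrable n d j).const_mul (c j)]
  refine Finset.sum_congr rfl fun j _ => ?_
  rw [intervalIntegral.integral_const_mul, integral_bspline hab hn]

/-! ### The quadrature rules -/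

theorem sum_Icc_int_eq_sum_range (F : ℤ → ℝ) (i : ℤ) (m : ℕ) :
    ∑ j ∈ Finset.Icc i (i + m - 1), F j = ∑ k ∈ Finset.range m, F (i + k) := by
  induction m with
  | zero => simp
  | succ m ih =>
    rw [Finset.sum_range_succ, ← ih]
    have h : Finset.Icc i (i + ((m + 1 : ℕ) : ℤ) - 1)
        = insert (i + (m : ℤ)) (Finset.Icc i (i + m - 1)) := by
      ext x
      simp only [Finset.mem_Icc, Finset.mem_insert]
      omega
    rw [h, Finset.sum_insert (by simp), add_comm]

/-- The integral of a spline on `d + m` uniform subintervals: only the first and the last `d`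
B-splines have supports shorter than `d + 1` subintervals. -/
theorem integral_spline_eq {a b : ℝ} (hab : a < b) (d m : ℕ) (hn : 0 < d + m) (c : ℤ → ℝ) :
    ∫ x in a..b, spline a b (d + m) d c x
      = mesh a b (d + m) / (d + 1) *
        (∑ k ∈ Finset.range d, (k + 1) * c (1 + k)
          + ∑ k ∈ Finset.range m, (d + 1) * c (d + 1 + k)
          + ∑ k ∈ Finset.range d, (d - k) * c (d + m + 1 + k)) := by
  set h := mesh a b (d + m) with hh
  rw [integral_spline hab hn]
  have e : ((d + m : ℕ) : ℤ) + (d : ℤ) = 1 + ((d + m + d : ℕ) : ℤ) - 1 := by push_cast; ring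
  rw [e, sum_Icc_int_eq_sum_range, Finset.sum_range_add, Finset.sum_range_add, mul_add, mul_add,
    Finset.mul_sum, Finset.mul_sum, Finset.mul_sum]
  have hb : b = a + ((d + m : ℕ) : ℝ) * h := by
    have h1 := knot_of_ge a b hn (i := ((d + m : ℕ) : ℤ)) le_rfl
    rw [knot_of_mem a b _ (by omega) le_rfl] at h1
    rw [← h1]
    push_cast
    ring
  have hd : (d + 1 : ℝ) ≠ 0 := by positivity
  -- The three groups are the supports clamped at `a`, of `k + 1` cells, the full supports of `d +
  -- 1` cells, and the supports clamped at `b`, of `d - k` cells. At least `d` cells are present, so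
  -- no support is clamped at both ends.
  refine congrArg₂ _ (congrArg₂ _ ?_ ?_) ?_
  · refine Finset.sum_congr rfl fun k hk => ?_
    have hk := Finset.mem_range.1 hk
    rw [knot_of_nonpos a b _ (i := 1 + (k : ℤ) - d - 1) (by omega),
      knot_of_mem a b _ (by omega) (by push_cast; omega), ← hh]
    push_cast
    field_simp
    ring
  · refine Finset.sum_congr rfl fun k hk => ?_
    have hk := Finset.mem_range.1 hk
    rw [knot_of_mem a b _ (i := 1 + ((d + k : ℕ) : ℤ) - d - 1) (by omega) (by push_cast; omega),
      knot_of_mem a b _ (by omega) (by push_cast; omega), ← hh]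
    rw [show (1 : ℤ) + ((d + k : ℕ) : ℤ) = d + 1 + k by push_cast; ring]
    push_cast
    field_simp
    ring
  · refine Finset.sum_congr rfl fun k hk => ?_
    have hk := Finset.mem_range.1 hk
    rw [knot_of_mem a b _ (i := 1 + ((d + m + k : ℕ) : ℤ) - d - 1) (by omega)
        (by push_cast; omega),
      knot_of_ge a b hn (by push_cast; omega), ← hh]
    rw [show (1 : ℤ) + ((d + m + k : ℕ) : ℤ) = d + m + 1 + k by push_cast; ring]
    nth_rewrite 1 [hb]
    push_cast
    field_simp
    ring

/-- The weights `-1/8, 10/8, -1/8` have sum one, so each added interior functional contributes one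
full inner value, and the defects stay at the two ends. The left ends of the functionals near `a`
and their mirror images near `b` then supply the remaining weights. The other three degrees follow
the same pattern. -/
theorem sum_range_mu2 (m : ℕ) (y : ℤ → ℝ) :
    ∑ k ∈ Finset.range 2, (k + 1) * mu2 (m + 4) y (1 + k)
      + ∑ k ∈ Finset.range (m + 2), 3 * mu2 (m + 4) y (3 + k)
      + ∑ k ∈ Finset.range 2, (2 - k) * mu2 (m + 4) y (m + 5 + k)
    = 3 * (∑ k ∈ Finset.range m, y (4 + k)
        + (1 / 9 * (y 1 + y (m + 6))
          + 7 / 8 * (y 2 + y (m + 5))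
          + 73 / 72 * (y 3 + y (m + 4)))) := by
  have hm : ∀ k ∈ Finset.range (m + 2), 3 * mu2 (m + 4) y (3 + k)
      = 3 / 8 * (-y (2 + k) + 10 * y (3 + k) - y (4 + k)) := by
    intro k hk
    have hk := Finset.mem_range.1 hk
    rw [mu2]
    repeat rw [if_neg (by omega)]
    ring_nf
  have hs : ∑ k ∈ Finset.range (m + 2), 3 / 8 * (-y (2 + k) + 10 * y (3 + k) - y (4 + k))
      = 3 * ∑ k ∈ Finset.range m, y (4 + k)
        + ((-3 / 8) * y 2 + 27 / 8 * y 3 + 27 / 8 * y (m + 4) + (-3 / 8) * y (m + 5)) := by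
    clear hm
    induction m with
    | zero => simp [Finset.sum_range_succ]; ring_nf
    | succ m ih =>
      rw [show m + 1 + 2 = m + 2 + 1 by ring, Finset.sum_range_succ, ih,
        Finset.sum_range_succ]
      push_cast
      ring_nf
  have v1 : mu2 (m + 4) y 1 = y 1 := by
    rw [mu2]
    rw [if_pos (by omega)]
  have v2 : mu2 (m + 4) y 2 = (1 / 6) * (-2 * y 1 + 9 * y 2 - y 3) := by
    rw [mu2]
    repeat rw [if_neg (by omega)]
    rw [if_pos (by omega)]
  have w1 : mu2 (m + 4) y (m + 5)
      = (1 / 6) * (-2 * y (m + 6) + 9 * y (m + 5) - y (m + 4)) := by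
    rw [mu2]
    repeat rw [if_neg (by omega)]
    rw [if_pos (by omega)]
    push_cast
    ring_nf
  have w2 : mu2 (m + 4) y (m + 6)
      = y (m + 6) := by
    rw [mu2]
    repeat rw [if_neg (by omega)]
    rw [if_pos (by omega)]
    push_cast
    ring_nf
  rw [Finset.sum_congr rfl hm, hs]
  simp only [Finset.sum_range_succ, Finset.sum_range_zero, Nat.cast_one,
    Nat.cast_zero, add_zero, add_assoc (m : ℤ), Int.reduceAdd, v1, v2, w1, w2]
  ring

theorem I2_eq {a b : ℝ} (hab : a < b) (f : ℝ → ℝ) (m : ℕ) :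
    I2 a b (m + 4) f
      = mesh a b (m + 4) * (∑ k ∈ Finset.range m, f (midpt a b (m + 4) (4 + k))
        + (1 / 9 * (f (midpt a b (m + 4) 1) + f (midpt a b (m + 4) (m + 6)))
          + 7 / 8 * (f (midpt a b (m + 4) 2) + f (midpt a b (m + 4) (m + 5)))
          + 73 / 72 * (f (midpt a b (m + 4) 3) + f (midpt a b (m + 4) (m + 4))))) := by
  have e : m + 4 = 2 + (m + 2) := by ring
  have hI := integral_spline_eq hab 2 (m + 2) (by omega)
    (mu2 (m + 4) fun j => f (midpt a b (m + 4) j))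
  have hs := sum_range_mu2 m fun j => f (midpt a b (m + 4) j)
  rw [← e] at hI
  unfold I2 Q2
  rw [hI]
  push_cast
  ring_nf at hs ⊢
  linear_combination mesh a b (4 + m) / 3 * hs

theorem sum_range_mu3 (m : ℕ) (y : ℤ → ℝ) :
    ∑ k ∈ Finset.range 3, (k + 1) * mu3 (m + 7) y (1 + k)
      + ∑ k ∈ Finset.range (m + 4), 4 * mu3 (m + 7) y (4 + k)
      + ∑ k ∈ Finset.range 3, (3 - k) * mu3 (m + 7) y (m + 8 + k)
    = 4 * (∑ k ∈ Finset.range m, y (4 + k)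
        + (23 / 72 * (y 0 + y (m + 7))
          + 4 / 3 * (y 1 + y (m + 6))
          + 19 / 24 * (y 2 + y (m + 5))
          + 19 / 18 * (y 3 + y (m + 4)))) := by
  have hm : ∀ k ∈ Finset.range (m + 4), 4 * mu3 (m + 7) y (4 + k)
      = 4 / 6 * (-y (1 + k) + 8 * y (2 + k) - y (3 + k)) := by
    intro k hk
    have hk := Finset.mem_range.1 hk
    rw [mu3]
    repeat rw [if_neg (by omega)]
    ring_nf
  have hs : ∑ k ∈ Finset.range (m + 4), 4 / 6 * (-y (1 + k) + 8 * y (2 + k) - y (3 + k))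
      = 4 * ∑ k ∈ Finset.range m, y (4 + k)
        + ((-2 / 3) * y 1 + 14 / 3 * y 2 + 4 * y 3 + 4 * y (m + 4) + 14 / 3 * y (m + 5)
          + (-2 / 3) * y (m + 6)) := by
    clear hm
    induction m with
    | zero => simp [Finset.sum_range_succ]; ring_nf
    | succ m ih =>
      rw [show m + 1 + 4 = m + 4 + 1 by ring, Finset.sum_range_succ, ih,
        Finset.sum_range_succ]
      push_cast
      ring_nf
  have v1 : mu3 (m + 7) y 1 = y 0 := by
    rw [mu3]
    rw [if_pos (by omega)]
  have v2 : mu3 (m + 7) y 2 = (1 / 18) * (7 * y 0 + 18 * y 1 - 9 * y 2 + 2 * y 3) := by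
    rw [mu3]
    repeat rw [if_neg (by omega)]
    rw [if_pos (by omega)]
  -- The third functional already has the interior form, although the support of its B-spline is
  -- still clamped at `a`. The mirror case is `w1`.
  have v3 : mu3 (m + 7) y 3 = (1 / 6) * (-y 0 + 8 * y 1 - y 2) := by
    rw [mu3]
    repeat rw [if_neg (by omega)]
    norm_num
  have w1 : mu3 (m + 7) y (m + 8)
      = (1 / 6) * (-y (m + 7) + 8 * y (m + 6) - y (m + 5)) := by
    rw [mu3]
    repeat rw [if_neg (by omega)]
    ring_nf
  have w2 : mu3 (m + 7) y (m + 9)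
      = (1 / 18) * (7 * y (m + 7) + 18 * y (m + 6) - 9 * y (m + 5) + 2 * y (m + 4)) := by
    rw [mu3]
    repeat rw [if_neg (by omega)]
    rw [if_pos (by omega)]
    push_cast
    ring_nf
  have w3 : mu3 (m + 7) y (m + 10)
      = y (m + 7) := by
    rw [mu3]
    repeat rw [if_neg (by omega)]
    rw [if_pos (by omega)]
    push_cast
    ring_nf
  rw [Finset.sum_congr rfl hm, hs]
  simp only [Finset.sum_range_succ, Finset.sum_range_zero, Nat.cast_ofNat, Nat.cast_one,
    Nat.cast_zero, add_zero, add_assoc (m : ℤ), Int.reduceAdd, v1, v2, v3, w1, w2, w3]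
  ring

theorem I3_eq {a b : ℝ} (hab : a < b) (f : ℝ → ℝ) (m : ℕ) :
    I3 a b (m + 7) f
      = mesh a b (m + 7) * (∑ k ∈ Finset.range m, f (knot a b (m + 7) (4 + k))
        + (23 / 72 * (f (knot a b (m + 7) 0) + f (knot a b (m + 7) (m + 7)))
          + 4 / 3 * (f (knot a b (m + 7) 1) + f (knot a b (m + 7) (m + 6)))
          + 19 / 24 * (f (knot a b (m + 7) 2) + f (knot a b (m + 7) (m + 5)))
          + 19 / 18 * (f (knot a b (m + 7) 3) + f (knot a b (m + 7) (m + 4))))) := by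
  have e : m + 7 = 3 + (m + 4) := by ring
  have hI := integral_spline_eq hab 3 (m + 4) (by omega)
    (mu3 (m + 7) fun j => f (knot a b (m + 7) j))
  have hs := sum_range_mu3 m fun j => f (knot a b (m + 7) j)
  rw [← e] at hI
  unfold I3 Q3
  rw [hI]
  push_cast
  ring_nf at hs ⊢
  linear_combination mesh a b (7 + m) / 4 * hs

theorem sum_range_mu4 (m : ℕ) (y : ℤ → ℝ) :
    ∑ k ∈ Finset.range 4, (k + 1) * mu4 (m + 8) y (1 + k)
      + ∑ k ∈ Finset.range (m + 4), 5 * mu4 (m + 8) y (5 + k)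
      + ∑ k ∈ Finset.range 4, (4 - k) * mu4 (m + 8) y (m + 9 + k)
    = 5 * (∑ k ∈ Finset.range m, y (6 + k)
        + (206 / 1575 * (y 1 + y (m + 10))
          + 107 / 128 * (y 2 + y (m + 9))
          + 6019 / 5760 * (y 3 + y (m + 8))
          + 9467 / 9600 * (y 4 + y (m + 7))
          + 13469 / 13440 * (y 5 + y (m + 6)))) := by
  have hm : ∀ k ∈ Finset.range (m + 4), 5 * mu4 (m + 8) y (5 + k)
      = 5 * (47 / 1152 * (y (2 + k) + y (6 + k)) - 107 / 288 * (y (3 + k) + y (5 + k))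
        + 319 / 192 * y (4 + k)) := by
    intro k hk
    have hk := Finset.mem_range.1 hk
    rw [mu4]
    repeat rw [if_neg (by omega)]
    ring_nf
  have hs : ∑ k ∈ Finset.range (m + 4), 5 * (47 / 1152 * (y (2 + k) + y (6 + k)) - 107 / 288 * (y (3 + k) + y (5 + k))
        + 319 / 192 * y (4 + k))
      = 5 * ∑ k ∈ Finset.range m, y (6 + k)
        + (235 / 1152 * y 2 + (-635 / 384) * y 3 + 2555 / 384 * y 4 + 5525 / 1152 * y 5
          + 5525 / 1152 * y (m + 6) + 2555 / 384 * y (m + 7) + (-635 / 384) * y (m + 8)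
          + 235 / 1152 * y (m + 9)) := by
    clear hm
    induction m with
    | zero => simp [Finset.sum_range_succ]; ring_nf
    | succ m ih =>
      rw [show m + 1 + 4 = m + 4 + 1 by ring, Finset.sum_range_succ, ih,
        Finset.sum_range_succ]
      push_cast
      ring_nf
  have v1 : mu4 (m + 8) y 1 = y 1 := by
    rw [mu4]
    rw [if_pos (by omega)]
  have v2 : mu4 (m + 8) y 2 = 17 / 105 * y 1 + 35 / 32 * y 2 - 35 / 96 * y 3 + 21 / 160 * y 4 - 5 / 224 * y 5 := by
    rw [mu4]
    repeat rw [if_neg (by omega)]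
    rw [if_pos (by omega)]
  have v3 : mu4 (m + 8) y 3 = -(19 / 45) * y 1 + 377 / 288 * y 2 + 61 / 288 * y 3 - 59 / 480 * y 4
        + 7 / 288 * y 5 := by
    rw [mu4]
    repeat rw [if_neg (by omega)]
    rw [if_pos (by omega)]
  have v4 : mu4 (m + 8) y 4 = 47 / 315 * y 1 - 77 / 144 * y 2 + 251 / 144 * y 3 - 97 / 240 * y 4
        + 47 / 1008 * y 5 := by
    rw [mu4]
    repeat rw [if_neg (by omega)]
    rw [if_pos (by omega)]
  have w1 : mu4 (m + 8) y (m + 9)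
      = 47 / 315 * y (m + 10) - 77 / 144 * y (m + 9) + 251 / 144 * y (m + 8) - 97 / 240 * y (m + 7)
        + 47 / 1008 * y (m + 6) := by
    rw [mu4]
    repeat rw [if_neg (by omega)]
    rw [if_pos (by omega)]
    push_cast
    ring_nf
  have w2 : mu4 (m + 8) y (m + 10)
      = -(19 / 45) * y (m + 10) + 377 / 288 * y (m + 9) + 61 / 288 * y (m + 8) - 59 / 480 * y (m + 7)
        + 7 / 288 * y (m + 6) := by
    rw [mu4]
    repeat rw [if_neg (by omega)]
    rw [if_pos (by omega)]
    push_cast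
    ring_nf
  have w3 : mu4 (m + 8) y (m + 11)
      = 17 / 105 * y (m + 10) + 35 / 32 * y (m + 9) - 35 / 96 * y (m + 8) + 21 / 160 * y (m + 7) - 5 / 224 * y (m + 6) := by
    rw [mu4]
    repeat rw [if_neg (by omega)]
    rw [if_pos (by omega)]
    push_cast
    ring_nf
  have w4 : mu4 (m + 8) y (m + 12)
      = y (m + 10) := by
    rw [mu4]
    repeat rw [if_neg (by omega)]
    rw [if_pos (by omega)]
    push_cast
    ring_nf
  rw [Finset.sum_congr rfl hm, hs]
  simp only [Finset.sum_range_succ, Finset.sum_range_zero, Nat.cast_ofNat, Nat.cast_one,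
    Nat.cast_zero, add_zero, add_assoc (m : ℤ), Int.reduceAdd, v1, v2, v3, v4, w1, w2, w3, w4]
  ring

theorem I4_eq {a b : ℝ} (hab : a < b) (f : ℝ → ℝ) (m : ℕ) :
    I4 a b (m + 8) f
      = mesh a b (m + 8) * (∑ k ∈ Finset.range m, f (midpt a b (m + 8) (6 + k))
        + (206 / 1575 * (f (midpt a b (m + 8) 1) + f (midpt a b (m + 8) (m + 10)))
          + 107 / 128 * (f (midpt a b (m + 8) 2) + f (midpt a b (m + 8) (m + 9)))
          + 6019 / 5760 * (f (midpt a b (m + 8) 3) + f (midpt a b (m + 8) (m + 8)))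
          + 9467 / 9600 * (f (midpt a b (m + 8) 4) + f (midpt a b (m + 8) (m + 7)))
          + 13469 / 13440 * (f (midpt a b (m + 8) 5) + f (midpt a b (m + 8) (m + 6))))) := by
  have e : m + 8 = 4 + (m + 4) := by ring
  have hI := integral_spline_eq hab 4 (m + 4) (by omega)
    (mu4 (m + 8) fun j => f (midpt a b (m + 8) j))
  have hs := sum_range_mu4 m fun j => f (midpt a b (m + 8) j)
  rw [← e] at hI
  unfold I4 Q4
  rw [hI]
  push_cast
  ring_nf at hs ⊢
  linear_combination mesh a b (8 + m) / 5 * hs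

theorem sum_range_mu5 (m : ℕ) (y : ℤ → ℝ) :
    ∑ k ∈ Finset.range 5, (k + 1) * mu5 (m + 11) y (1 + k)
      + ∑ k ∈ Finset.range (m + 6), 6 * mu5 (m + 11) y (6 + k)
      + ∑ k ∈ Finset.range 5, (5 - k) * mu5 (m + 11) y (m + 12 + k)
    = 6 * (∑ k ∈ Finset.range m, y (6 + k)
        + (157 / 480 * (y 0 + y (m + 11))
          + 961 / 720 * (y 1 + y (m + 10))
          + 133 / 180 * (y 2 + y (m + 9))
          + 271 / 240 * (y 3 + y (m + 8))
          + 1393 / 1440 * (y 4 + y (m + 7))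
          + 361 / 360 * (y 5 + y (m + 6)))) := by
  have hm : ∀ k ∈ Finset.range (m + 6), 6 * mu5 (m + 11) y (6 + k)
      = 6 * (13 / 240 * (y (1 + k) + y (5 + k)) - 7 / 15 * (y (2 + k) + y (4 + k))
        + 73 / 40 * y (3 + k)) := by
    intro k hk
    have hk := Finset.mem_range.1 hk
    rw [mu5]
    repeat rw [if_neg (by omega)]
    ring_nf
  have hs : ∑ k ∈ Finset.range (m + 6), 6 * (13 / 240 * (y (1 + k) + y (5 + k)) - 7 / 15 * (y (2 + k) + y (4 + k))
        + 73 / 40 * y (3 + k))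
      = 6 * ∑ k ∈ Finset.range m, y (6 + k)
        + (13 / 40 * y 1 + (-99 / 40) * y 2 + 339 / 40 * y 3 + 227 / 40 * y 4 + 6 * y 5
          + 6 * y (m + 6) + 227 / 40 * y (m + 7) + 339 / 40 * y (m + 8)
          + (-99 / 40) * y (m + 9) + 13 / 40 * y (m + 10)) := by
    clear hm
    induction m with
    | zero => simp [Finset.sum_range_succ]; ring_nf
    | succ m ih =>
      rw [show m + 1 + 6 = m + 6 + 1 by ring, Finset.sum_range_succ, ih,
        Finset.sum_range_succ]
      push_cast
      ring_nf
  have v1 : mu5 (m + 11) y 1 = y 0 := by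
    rw [mu5]
    rw [if_pos (by omega)]
  have v2 : mu5 (m + 11) y 2 = 163 / 300 * y 0 + y 1 - y 2 + 2 / 3 * y 3 - 1 / 4 * y 4 + 1 / 25 * y 5 := by
    rw [mu5]
    repeat rw [if_neg (by omega)]
    rw [if_pos (by omega)]
  have v3 : mu5 (m + 11) y 3 = 1 / 200 * y 0 + 103 / 60 * y 1 - 73 / 60 * y 2 + 7 / 10 * y 3 - 29 / 120 * y 4
        + 11 / 300 * y 5 := by
    rw [mu5]
    repeat rw [if_neg (by omega)]
    rw [if_pos (by omega)]
  have v4 : mu5 (m + 11) y 4 = -(41 / 400) * y 0 + 43 / 60 * y 1 + 103 / 120 * y 2 - 7 / 10 * y 3 + 13 / 48 * y 4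
        - 13 / 300 * y 5 := by
    rw [mu5]
    repeat rw [if_neg (by omega)]
    rw [if_pos (by omega)]
  -- As for the cubic, the functional is interior while the support of the fifth B-spline is clamped
  -- at `a`.
  have v5 : mu5 (m + 11) y 5 = 13 / 240 * (y 0 + y 4) - 7 / 15 * (y 1 + y 3) + 73 / 40 * y 2 := by
    rw [mu5]
    repeat rw [if_neg (by omega)]
    norm_num
  have w1 : mu5 (m + 11) y (m + 12)
      = 13 / 240 * (y (m + 11) + y (m + 7)) - 7 / 15 * (y (m + 10) + y (m + 8)) + 73 / 40 * y (m + 9) := by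
    rw [mu5]
    repeat rw [if_neg (by omega)]
    ring_nf
  have w2 : mu5 (m + 11) y (m + 13)
      = -(41 / 400) * y (m + 11) + 43 / 60 * y (m + 10) + 103 / 120 * y (m + 9) - 7 / 10 * y (m + 8) + 13 / 48 * y (m + 7)
        - 13 / 300 * y (m + 6) := by
    rw [mu5]
    repeat rw [if_neg (by omega)]
    rw [if_pos (by omega)]
    push_cast
    ring_nf
  have w3 : mu5 (m + 11) y (m + 14)
      = 1 / 200 * y (m + 11) + 103 / 60 * y (m + 10) - 73 / 60 * y (m + 9) + 7 / 10 * y (m + 8) - 29 / 120 * y (m + 7)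
        + 11 / 300 * y (m + 6) := by
    rw [mu5]
    repeat rw [if_neg (by omega)]
    rw [if_pos (by omega)]
    push_cast
    ring_nf
  have w4 : mu5 (m + 11) y (m + 15)
      = 163 / 300 * y (m + 11) + y (m + 10) - y (m + 9) + 2 / 3 * y (m + 8) - 1 / 4 * y (m + 7) + 1 / 25 * y (m + 6) := by
    rw [mu5]
    repeat rw [if_neg (by omega)]
    rw [if_pos (by omega)]
    push_cast
    ring_nf
  have w5 : mu5 (m + 11) y (m + 16)
      = y (m + 11) := by
    rw [mu5]
    repeat rw [if_neg (by omega)]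
    rw [if_pos (by omega)]
    push_cast
    ring_nf
  rw [Finset.sum_congr rfl hm, hs]
  simp only [Finset.sum_range_succ, Finset.sum_range_zero, Nat.cast_ofNat, Nat.cast_one,
    Nat.cast_zero, add_zero, add_assoc (m : ℤ), Int.reduceAdd, v1, v2, v3, v4, v5, w1, w2, w3, w4, w5]
  ring

theorem I5_eq {a b : ℝ} (hab : a < b) (f : ℝ → ℝ) (m : ℕ) :
    I5 a b (m + 11) f
      = mesh a b (m + 11) * (∑ k ∈ Finset.range m, f (knot a b (m + 11) (6 + k))
        + (157 / 480 * (f (knot a b (m + 11) 0) + f (knot a b (m + 11) (m + 11)))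
          + 961 / 720 * (f (knot a b (m + 11) 1) + f (knot a b (m + 11) (m + 10)))
          + 133 / 180 * (f (knot a b (m + 11) 2) + f (knot a b (m + 11) (m + 9)))
          + 271 / 240 * (f (knot a b (m + 11) 3) + f (knot a b (m + 11) (m + 8)))
          + 1393 / 1440 * (f (knot a b (m + 11) 4) + f (knot a b (m + 11) (m + 7)))
          + 361 / 360 * (f (knot a b (m + 11) 5) + f (knot a b (m + 11) (m + 6))))) := by
  have e : m + 11 = 5 + (m + 6) := by ring
  have hI := integral_spline_eq hab 5 (m + 6) (by omega)
    (mu5 (m + 11) fun j => f (knot a b (m + 11) j))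
  have hs := sum_range_mu5 m fun j => f (knot a b (m + 11) j)
  rw [← e] at hI
  unfold I5 Q5
  rw [hI]
  push_cast
  ring_nf at hs ⊢
  linear_combination mesh a b (11 + m) / 6 * hs

/-! ### Smooth extensions and Taylor expansions -/

/-- The derivative is extended by induction and integrated from `a`; a continuous function is
extended by constants. The extension allows Taylor expansion about any point of the interval,
endpoints included, with ordinary derivatives. -/
theorem exists_contDiff_extension {a b : ℝ} (hab : a < b) (m : ℕ) {f : ℝ → ℝ}
    (hf : ContDiffOn ℝ m f (Set.Icc a b)) :
    ∃ g : ℝ → ℝ, ContDiff ℝ m g ∧ Set.EqOn f g (Set.Icc a b) := by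
  induction m generalizing f with
  | zero =>
    refine ⟨Set.IccExtend hab.le (Set.domRestrict (Set.Icc a b) f), ?_, ?_⟩
    · have h : Continuous (Set.domRestrict (Set.Icc a b) f) :=
        continuousOn_iff_continuous_domRestrict.1 hf.continuousOn
      exact contDiff_zero.2 h.Icc_extend'
    · intro x hx
      rw [Set.IccExtend_of_mem hab.le _ hx]
      rfl
  | succ m ih =>
    have hu : UniqueDiffOn ℝ (Set.Icc a b) := uniqueDiffOn_Icc hab
    have hf' := (contDiffOn_succ_iff_derivWithin (n := (m : WithTop ℕ∞)) hu).1
      (by exact_mod_cast hf)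
    obtain ⟨g', hg', he⟩ := ih hf'.2.2
    have hder : ∀ x, HasDerivAt (fun x => f a + ∫ t in a..x, g' t) (g' x) x := fun x =>
      ((hg'.continuous.integral_hasStrictDerivAt a x).hasDerivAt).const_add _
    refine ⟨fun x => f a + ∫ t in a..x, g' t, ?_, ?_⟩
    · have : ContDiff ℝ ((m : WithTop ℕ∞) + 1) fun x => f a + ∫ t in a..x, g' t := by
        rw [contDiff_succ_iff_deriv]
        refine ⟨fun x => (hder x).differentiableAt, by simp, ?_⟩
        rw [show deriv (fun x => f a + ∫ t in a..x, g' t) = g' from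
          funext fun x => (hder x).deriv]
        exact hg'
      exact_mod_cast this
    · intro x hx
      have hsub : Set.Icc a x ⊆ Set.Icc a b := Set.Icc_subset_Icc_right hx.2
      have h := intervalIntegral.integral_eq_sub_of_hasDerivAt_of_le hx.1
        (hf.continuousOn.mono hsub) (f' := g') (fun t ht => ?_)
        (hg'.continuous.intervalIntegrable _ _)
      · simp only [h]
        ring
      · have ht' : t ∈ Set.Ioo a b := ⟨ht.1, ht.2.trans_le hx.2⟩
        rw [← he (Set.Ioo_subset_Icc_self ht')]
        exact ((hf'.1 t (Set.Ioo_subset_Icc_self ht')).hasDerivWithinAt).hasDerivAt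
          (Icc_mem_nhds ht'.1 ht'.2)

/-- Taylor's formula with integral remainder for a function that is smooth on the whole line. -/
theorem taylor_integral {g : ℝ → ℝ} {m : ℕ} (hg : ContDiff ℝ (m + 1 : ℕ) g) (c x : ℝ) :
    g x = ∑ k ∈ Finset.range (m + 1), iteratedDeriv k g c / k.factorial * (x - c) ^ k
      + ∫ t in c..x, (x - t) ^ m / m.factorial * iteratedDeriv (m + 1) g t := by
  -- A degenerate interval has no unique derivatives. There only the term `k = 0` survives.
  rcases eq_or_ne c x with rfl | hne
  · rw [intervalIntegral.integral_same, Finset.sum_range_succ']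
    simp
  have hu : UniqueDiffOn ℝ (Set.uIcc c x) := uniqueDiffOn_uIcc hne
  have hd : ∀ k ≤ m + 1, ∀ t ∈ Set.uIcc c x,
      iteratedDerivWithin k g (Set.uIcc c x) t = iteratedDeriv k g t := fun k hk t ht =>
    iteratedDerivWithin_eq_iteratedDeriv hu
      ((hg.of_le (by exact_mod_cast hk)).contDiffAt) ht
  have h := taylor_integral_remainder (x := x) (x₀ := c) (n := m) hg.contDiffOn
  rw [taylor_within_apply] at h
  rw [← sub_eq_iff_eq_add']
  convert h using 1
  · congr 1
    refine Finset.sum_congr rfl fun k hk => ?_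
    rw [hd k (by have := Finset.mem_range.1 hk; omega) c Set.left_mem_uIcc, smul_eq_mul]
    ring
  · refine intervalIntegral.integral_congr fun t ht => ?_
    simp only [hd (m + 1) le_rfl t ht, smul_eq_mul]

/-- The constant bounds the derivative of order `m + 1` on the whole compact interval, so it does
not depend on the centre. The factor `1 / m!` is discarded. -/
theorem exists_taylor_bound {a b : ℝ} {g : ℝ → ℝ} {m : ℕ}
    (hg : ContDiff ℝ (m + 1 : ℕ) g) :
    ∃ M : ℝ, 0 ≤ M ∧ ∀ c ∈ Set.Icc a b, ∀ x ∈ Set.Icc a b,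
      |g x - ∑ k ∈ Finset.range (m + 1), iteratedDeriv k g c / k.factorial * (x - c) ^ k|
        ≤ M * |x - c| ^ (m + 1) := by
  have hcont : Continuous (iteratedDeriv (m + 1) g) := hg.continuous_iteratedDeriv _ le_rfl
  obtain ⟨M, hM⟩ := isCompact_Icc.exists_bound_of_continuousOn (s := Set.Icc a b)
    hcont.continuousOn
  refine ⟨max M 0, le_max_right _ _, fun c hc x hx => ?_⟩
  nth_rewrite 1 [taylor_integral hg c x]
  rw [add_sub_cancel_left, ← Real.norm_eq_abs, pow_succ, ← mul_assoc]
  refine intervalIntegral.norm_integral_le_of_norm_le_const fun t ht => ?_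
  have ht' : t ∈ Set.uIcc c x := Set.uIoc_subset_uIcc ht
  have hxt : |x - t| ≤ |x - c| := by
    rw [abs_sub_comm x c]
    exact Set.abs_sub_right_of_mem_uIcc ht' |>.trans_eq (abs_sub_comm _ _)
  have htab : t ∈ Set.Icc a b := Set.uIcc_subset_Icc hc hx ht'
  have h1 : ‖(x - t) ^ m / (m.factorial : ℝ)‖ ≤ |x - c| ^ m := by
    rw [norm_div, norm_pow, Real.norm_eq_abs, Real.norm_natCast]
    refine (div_le_self (by positivity) ?_).trans (by gcongr)
    exact_mod_cast Nat.one_le_iff_ne_zero.2 (Nat.factorial_ne_zero m)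
  rw [norm_mul, mul_comm (max M 0)]
  exact mul_le_mul h1 ((hM t htab).trans (le_max_left _ _)) (norm_nonneg _) (by positivity)

/-! ### Local quadrature formulas -/

/-- The error at scale `h` about `c` of the formula `∫_α^β g ≈ ∑ w g(σ)`, where `(w, σ)` runs
over the list `l` of weights and nodes. -/
def localErr (g : ℝ → ℝ) (c h α β : ℝ) (l : List (ℝ × ℝ)) : ℝ :=
  (∫ x in (c + α * h)..(c + β * h), g x) - h * (l.map fun p => p.1 * g (c + p.2 * h)).sum

/-- The formula `∫_α^β g ≈ ∑ w g(σ)` is exact for polynomials of degree at most `m`. -/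
def IsExact (m : ℕ) (α β : ℝ) (l : List (ℝ × ℝ)) : Prop :=
  ∀ k ≤ m, (β ^ (k + 1) - α ^ (k + 1)) / (k + 1) = (l.map fun p => p.1 * p.2 ^ k).sum

theorem localErr_add {g₁ g₂ : ℝ → ℝ} (h₁ : Continuous g₁) (h₂ : Continuous g₂) (c h α β : ℝ)
    (l : List (ℝ × ℝ)) :
    localErr (fun x => g₁ x + g₂ x) c h α β l
      = localErr g₁ c h α β l + localErr g₂ c h α β l := by
  unfold localErr
  rw [intervalIntegral.integral_add (h₁.intervalIntegrable _ _) (h₂.intervalIntegrable _ _)]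
  simp only [mul_add, List.sum_map_add]
  ring

theorem localErr_monomial {m : ℕ} {α β : ℝ} {l : List (ℝ × ℝ)} (hl : IsExact m α β l) {k : ℕ}
    (hk : k ≤ m) (A c h : ℝ) :
    localErr (fun x => A * (x - c) ^ k) c h α β l = 0 := by
  have h1 : ∫ x in (c + α * h)..(c + β * h), A * (x - c) ^ k
      = A * h ^ (k + 1) * ((β ^ (k + 1) - α ^ (k + 1)) / (k + 1)) := by
    rw [intervalIntegral.integral_const_mul,
      intervalIntegral.integral_comp_sub_right (fun x => x ^ k), integral_pow]
    ring
  have h2 : (l.map fun p => p.1 * (A * (c + p.2 * h - c) ^ k)).sum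
      = A * h ^ k * (l.map fun p => p.1 * p.2 ^ k).sum := by
    rw [← List.sum_map_mul_left]
    congr 1
    refine List.map_congr_left fun p _ => ?_
    ring
  rw [localErr, h1, h2, hl k hk]
  ring

theorem localErr_polynomial {m : ℕ} {α β : ℝ} {l : List (ℝ × ℝ)} (hl : IsExact m α β l)
    (A : ℕ → ℝ) (c h : ℝ) :
    localErr (fun x => ∑ k ∈ Finset.range (m + 1), A k * (x - c) ^ k) c h α β l = 0 := by
  have key : ∀ r ≤ m + 1,
      localErr (fun x => ∑ k ∈ Finset.range r, A k * (x - c) ^ k) c h α β l = 0 := by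
    intro r hr
    induction r with
    | zero => simp [localErr]
    | succ r ih =>
      simp only [Finset.sum_range_succ]
      rw [localErr_add (by fun_prop) (by fun_prop), ih (by omega),
        localErr_monomial hl (by omega), add_zero]
  exact key _ le_rfl

/-- The error functional annihilates the Taylor polynomial of degree `m` at `c`, so it sees only the
remainder, which is `O(|h| ^ (m + 1))` at all nodes; the integration or the factor `h` gives one
more power. Neither the position `c` nor the scale enters the constant, and `h` may be negative,
which serves the right end by reflection. -/
theorem exists_localErr_bound {a b : ℝ} {g : ℝ → ℝ} {m : ℕ} (hg : ContDiff ℝ (m + 1 : ℕ) g)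
    {α β : ℝ} {l : List (ℝ × ℝ)} (hl : IsExact m α β l) :
    ∃ K : ℝ, 0 ≤ K ∧ ∀ c ∈ Set.Icc a b, ∀ h : ℝ, c + α * h ∈ Set.Icc a b →
      c + β * h ∈ Set.Icc a b → (∀ p ∈ l, c + p.2 * h ∈ Set.Icc a b) →
      |localErr g c h α β l| ≤ K * |h| ^ (m + 2) := by
  obtain ⟨M, hM0, hM⟩ := exists_taylor_bound (a := a) (b := b) hg
  set S := (l.map fun p => |p.1| * |p.2| ^ (m + 1)).sum with hS
  have hS0 : 0 ≤ S := List.sum_nonneg (by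
    intro x hx
    obtain ⟨p, -, rfl⟩ := List.mem_map.1 hx
    positivity)
  refine ⟨M * (|α| + |β|) ^ (m + 1) * |β - α| + M * S, by positivity, ?_⟩
  intro c hc h hα hβ hp
  set P : ℝ → ℝ := fun x =>
    ∑ k ∈ Finset.range (m + 1), iteratedDeriv k g c / k.factorial * (x - c) ^ k with hP
  have hPc : Continuous P := by fun_prop
  have hgc : Continuous g := hg.continuous
  have e : localErr g c h α β l = localErr (fun x => g x - P x) c h α β l := by
    have h1 := localErr_add (g₂ := fun x => g x - P x) hPc (hgc.sub hPc) c h α β l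
    rw [localErr_polynomial hl, zero_add] at h1
    simpa only [add_sub_cancel] using h1
  have hnode : ∀ (r : List (ℝ × ℝ)), (∀ p ∈ r, c + p.2 * h ∈ Set.Icc a b) →
      |(r.map fun p => p.1 * (g (c + p.2 * h) - P (c + p.2 * h))).sum|
        ≤ M * (r.map fun p => |p.1| * |p.2| ^ (m + 1)).sum * |h| ^ (m + 1) := by
    intro r
    induction r with
    | nil => simp
    | cons p r ih =>
      intro hr
      have h1 := ih fun q hq => hr q (List.mem_cons_of_mem _ hq)
      have h2 : |g (c + p.2 * h) - P (c + p.2 * h)| ≤ M * |c + p.2 * h - c| ^ (m + 1) :=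
        hM c hc _ (hr p List.mem_cons_self)
      rw [add_sub_cancel_left, abs_mul, mul_pow] at h2
      simp only [List.map_cons, List.sum_cons]
      refine (abs_add_le _ _).trans ?_
      rw [abs_mul]
      have h3 := mul_le_mul_of_nonneg_left h2 (abs_nonneg p.1)
      linarith
  have hint : |∫ x in (c + α * h)..(c + β * h), (g x - P x)|
      ≤ M * ((|α| + |β|) * |h|) ^ (m + 1) * |c + β * h - (c + α * h)| := by
    rw [← Real.norm_eq_abs]
    refine intervalIntegral.norm_integral_le_of_norm_le_const fun x hx => ?_
    have hx' := Set.uIoc_subset_uIcc hx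
    have hxc : |x - c| ≤ (|α| + |β|) * |h| := by
      have h1 : |α * h| ≤ (|α| + |β|) * |h| := by
        rw [abs_mul]; nlinarith [abs_nonneg β, abs_nonneg h]
      have h2 : |β * h| ≤ (|α| + |β|) * |h| := by
        rw [abs_mul]; nlinarith [abs_nonneg α, abs_nonneg h]
      rw [abs_le] at h1 h2 ⊢
      rcases Set.mem_uIcc.1 hx' with h3 | h3 <;> constructor <;> linarith [h3.1, h3.2]
    refine (hM c hc x (Set.uIcc_subset_Icc hα hβ hx')).trans ?_
    gcongr
  rw [e, localErr]
  refine (abs_sub _ _).trans ?_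
  rw [abs_mul]
  have h1 := mul_le_mul_of_nonneg_left (hnode l hp) (abs_nonneg h)
  have h2 : |c + β * h - (c + α * h)| = |β - α| * |h| := by
    rw [← abs_mul]; congr 1; ring
  rw [h2] at hint
  calc _ ≤ M * ((|α| + |β|) * |h|) ^ (m + 1) * (|β - α| * |h|) + |h| * (M * S * |h| ^ (m + 1)) :=
        add_le_add hint h1
    _ = _ := by rw [mul_pow]; ring

theorem localErr_congr {a b : ℝ} {f g : ℝ → ℝ} (hfg : Set.EqOn f g (Set.Icc a b))
    {c h α β : ℝ} {l : List (ℝ × ℝ)} (hα : c + α * h ∈ Set.Icc a b)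
    (hβ : c + β * h ∈ Set.Icc a b) (hp : ∀ p ∈ l, c + p.2 * h ∈ Set.Icc a b) :
    localErr f c h α β l = localErr g c h α β l := by
  unfold localErr
  congr 1
  · exact intervalIntegral.integral_congr fun x hx => hfg (Set.uIcc_subset_Icc hα hβ hx)
  · congr 2
    exact List.map_congr_left fun p hp' => by rw [hfg (hp p hp')]

/-- A composite formula with `s` cells at either end, where a formula exact to degree `q` is
used, and `N` interior blocks of width `2 r`, where a formula exact to degree `q + 1` is used,
has an error of order `h ^ (q + 2)`. -/
theorem exists_composite_bound {a b : ℝ} (hab : a < b) {f : ℝ → ℝ} {q : ℕ}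
    (hf : ContDiffOn ℝ (q + 2 : ℕ) f (Set.Icc a b)) {s r L : ℝ} (hr : 0 < r) (hs : 0 < s)
    (hsL : s ≤ L) {lE lI : List (ℝ × ℝ)} (hE : IsExact q 0 s lE)
    (hI : IsExact (q + 1) (-r) r lI) (hEL : ∀ p ∈ lE, 0 ≤ p.2 ∧ p.2 ≤ L)
    (hIL : ∀ p ∈ lI, |p.2| ≤ s + r) :
    ∃ C : ℝ, ∀ n N : ℕ, 0 < n → L ≤ n → 2 * s + 2 * r * N = n →
      |(∫ x in a..b, f x) - mesh a b n *
        ((lE.map fun p => p.1 * f (a + p.2 * mesh a b n)).sum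
          + ∑ k ∈ Finset.range N,
              (lI.map fun p => p.1 * f (a + (s + r + 2 * r * k + p.2) * mesh a b n)).sum
          + (lE.map fun p => p.1 * f (a + (n - p.2) * mesh a b n)).sum)|
      ≤ C * mesh a b n ^ (q + 2) := by
  obtain ⟨g, hg, hfg⟩ := exists_contDiff_extension hab _ hf
  obtain ⟨K₁, hK₁, hb₁⟩ := exists_localErr_bound (a := a) (b := b) (m := q)
    (hg.of_le (by norm_cast; omega)) hE
  obtain ⟨K₂, hK₂, hb₂⟩ := exists_localErr_bound (a := a) (b := b) (m := q + 1) hg hI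
  -- One `K₁` belongs to each end. The `N` blocks of error `K₂ * h ^ (q + 3)` lose one power of `h`
  -- through `N * h ≤ (b - a) / (2 * r)`.
  refine ⟨2 * K₁ + K₂ * ((b - a) / (2 * r)), fun n N hn hLn hN => ?_⟩
  have hh := mesh_pos hab hn
  have hnh : a + n * mesh a b n = b := by
    have hn' : (n : ℝ) ≠ 0 := by exact_mod_cast hn.ne'
    unfold mesh
    field_simp
    ring
  set h := mesh a b n with hh'
  have hmem : ∀ t : ℝ, 0 ≤ t → t ≤ n → a + t * h ∈ Set.Icc a b := by
    intro t h0 hn'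
    constructor
    · nlinarith
    · rw [← hnh]; gcongr
  have hint : ∀ t u : ℝ, 0 ≤ t → t ≤ n → 0 ≤ u → u ≤ n →
      IntervalIntegrable f volume (a + t * h) (a + u * h) := fun t u h1 h2 h3 h4 =>
    (hf.continuousOn.mono (Set.uIcc_subset_Icc (hmem t h1 h2) (hmem u h3 h4))).intervalIntegrable
  have hN0 : 0 ≤ r * N := by positivity
  have hk : ∀ k ∈ Finset.range N, (k : ℝ) + 1 ≤ N := fun k hk => by
    exact_mod_cast Finset.mem_range.1 hk
  have hrk : ∀ k ∈ Finset.range N, r * k + r ≤ r * N := fun k hk' => by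
    have := mul_le_mul_of_nonneg_left (hk k hk') hr.le
    linarith
  have hrk0 : ∀ k : ℕ, 0 ≤ r * k := fun k => by positivity
  have hrefl : ∀ t : ℝ, b + t * -h = a + (n - t) * h := fun t => by rw [← hnh]; ring
  -- The right end is the left formula at `b` with scale `-h`. This reverses the orientation of the
  -- integral and the sign of the sum, so its local error is subtracted.
  have key : (∫ x in a..b, f x) - h *
        ((lE.map fun p => p.1 * f (a + p.2 * h)).sum
          + ∑ k ∈ Finset.range N,
              (lI.map fun p => p.1 * f (a + (s + r + 2 * r * k + p.2) * h)).sum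
          + (lE.map fun p => p.1 * f (a + (n - p.2) * h)).sum)
      = localErr f a h 0 s lE
        + ∑ k ∈ Finset.range N, localErr f (a + (s + r + 2 * r * k) * h) h (-r) r lI
        - localErr f b (-h) 0 s lE := by
    have h1 : ∑ k ∈ Finset.range N, ∫ x in (a + (s + r + 2 * r * k) * h + -r * h)..
          (a + (s + r + 2 * r * k) * h + r * h), f x
        = ∫ x in (a + s * h)..(a + (n - s) * h), f x := by
      have h2 := intervalIntegral.sum_integral_adjacent_intervals (μ := volume) (f := f)
        (a := fun k : ℕ => a + (s + 2 * r * k) * h) (n := N) (fun k hk' => by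
          have := hrk k (Finset.mem_range.2 hk')
          have := hrk0 k
          push_cast
          exact hint _ _ (by linarith) (by linarith) (by linarith) (by linarith))
      simp only [Nat.cast_zero, mul_zero, add_zero] at h2
      rw [show s + 2 * r * N = n - s by linarith] at h2
      rw [← h2]
      refine Finset.sum_congr rfl fun k _ => ?_
      congr 1
      · ring
      · push_cast; ring
    have h3 : ∫ x in a..b, f x = (∫ x in (a + 0 * h)..(a + s * h), f x)
        + (∫ x in (a + s * h)..(a + (n - s) * h), f x)
        + ∫ x in (a + (n - s) * h)..(a + (n - 0) * h), f x := by
      rw [intervalIntegral.integral_add_adjacent_intervals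
          (hint _ _ le_rfl (by linarith) (by linarith) (by linarith))
          (hint _ _ (by linarith) (by linarith) (by linarith) (by linarith)),
        intervalIntegral.integral_add_adjacent_intervals
          (hint _ _ le_rfl (by linarith) (by linarith) (by linarith))
          (hint _ _ (by linarith) (by linarith) (by linarith) (by linarith))]
      rw [sub_zero, hnh, zero_mul, add_zero]
    simp only [localErr, Finset.sum_sub_distrib, hrefl]
    rw [h1, h3, ← Finset.mul_sum, 
      intervalIntegral.integral_symm (a + (n - s) * h) (a + (n - 0) * h)]
    have h4 : ∀ (k : ℕ) (p : ℝ × ℝ), a + (s + r + 2 * r * k) * h + p.2 * h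
        = a + (s + r + 2 * r * k + p.2) * h := fun k p => by ring
    simp only [h4]
    ring
  have hEn : ∀ p ∈ lE, 0 ≤ p.2 ∧ p.2 ≤ n := fun p hp =>
    ⟨(hEL p hp).1, (hEL p hp).2.trans hLn⟩
  have hleft : |localErr f a h 0 s lE| ≤ K₁ * h ^ (q + 2) := by
    have c1 : a + 0 * h ∈ Set.Icc a b := hmem 0 le_rfl (Nat.cast_nonneg n)
    have c2 : a + s * h ∈ Set.Icc a b := hmem s hs.le (hsL.trans hLn)
    have c3 : ∀ p ∈ lE, a + p.2 * h ∈ Set.Icc a b := fun p hp =>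
      hmem _ (hEn p hp).1 (hEn p hp).2
    rw [localErr_congr hfg c1 c2 c3]
    simpa only [abs_of_pos hh] using hb₁ a ⟨le_rfl, hab.le⟩ h c1 c2 c3
  have hright : |localErr f b (-h) 0 s lE| ≤ K₁ * h ^ (q + 2) := by
    have c : ∀ t : ℝ, 0 ≤ t → t ≤ n → b + t * -h ∈ Set.Icc a b := fun t h1 h2 => by
      rw [hrefl]
      exact hmem _ (by linarith) (by linarith)
    have c1 := c 0 le_rfl (Nat.cast_nonneg n)
    have c2 := c s hs.le (hsL.trans hLn)
    have c3 : ∀ p ∈ lE, b + p.2 * -h ∈ Set.Icc a b := fun p hp =>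
      c _ (hEn p hp).1 (hEn p hp).2
    rw [localErr_congr hfg c1 c2 c3]
    simpa only [abs_neg, abs_of_pos hh] using hb₁ b ⟨hab.le, le_rfl⟩ (-h) c1 c2 c3
  have hmid : |∑ k ∈ Finset.range N, localErr f (a + (s + r + 2 * r * k) * h) h (-r) r lI|
      ≤ N * (K₂ * h ^ (q + 1 + 2)) := by
    refine (Finset.abs_sum_le_sum_abs _ _).trans ?_
    have : ∀ k ∈ Finset.range N, |localErr f (a + (s + r + 2 * r * k) * h) h (-r) r lI|
        ≤ K₂ * h ^ (q + 1 + 2) := by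
      intro k hk'
      have h1 := hrk k hk'
      have h2 := hrk0 k
      have c : ∀ t : ℝ, |t| ≤ s + r → a + (s + r + 2 * r * k) * h + t * h ∈ Set.Icc a b := by
        intro t ht
        rw [add_assoc, ← add_mul]
        have ht' := abs_le.1 ht
        exact hmem _ (by linarith) (by linarith)
      have c1 := c (-r) (by rw [abs_neg, abs_of_pos hr]; linarith)
      have c2 := c r (by rw [abs_of_pos hr]; linarith)
      have c3 : ∀ p ∈ lI, a + (s + r + 2 * r * k) * h + p.2 * h ∈ Set.Icc a b := fun p hp =>
        c _ (hIL p hp)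
      rw [localErr_congr hfg c1 c2 c3]
      simpa only [abs_of_pos hh] using
        hb₂ _ (hmem _ (by linarith) (by linarith)) h c1 c2 c3
    refine (Finset.sum_le_card_nsmul _ _ _ this).trans ?_
    rw [Finset.card_range, nsmul_eq_mul]
  rw [key]
  have hNh : N * h ≤ (b - a) / (2 * r) := by
    rw [le_div_iff₀ (by positivity)]
    have : (2 * r * N) * h ≤ n * h := by
      gcongr
      linarith
    linarith
  calc _ ≤ K₁ * h ^ (q + 2) + N * (K₂ * h ^ (q + 1 + 2)) + K₁ * h ^ (q + 2) :=
        (abs_sub _ _).trans (add_le_add ((abs_add_le _ _).trans (add_le_add hleft hmid)) hright)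
    _ = (2 * K₁ + K₂ * (N * h)) * h ^ (q + 2) := by ring
    _ ≤ _ := by gcongr

/-! ### Orders of the errors -/

theorem midpt_first (a b : ℝ) (n : ℕ) : midpt a b n 1 = a := by
  rw [midpt, knot_of_nonpos a b n (by omega), knot_of_nonpos a b n (by omega)]
  ring

theorem midpt_last (a b : ℝ) {n : ℕ} (hn : 0 < n) : midpt a b n (n + 2) = b := by
  rw [midpt, knot_of_ge a b hn (by omega), knot_of_ge a b hn (by omega)]
  ring

theorem midpt_of_mem (a b : ℝ) (n : ℕ) {j : ℤ} (h0 : 2 ≤ j) (hj : j ≤ n + 1) :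
    midpt a b n j = a + (j - 3 / 2) * mesh a b n := by
  rw [midpt, knot_of_mem a b n (by omega) (by omega), knot_of_mem a b n (by omega) (by omega)]
  push_cast
  ring

theorem add_mul_mesh (a b : ℝ) {n : ℕ} (hn : 0 < n) : a + n * mesh a b n = b := by
  have : (n : ℝ) ≠ 0 := by exact_mod_cast hn.ne'
  unfold mesh
  field_simp
  ring

theorem sum_knot_eq (a b : ℝ) (f : ℝ → ℝ) {n m i : ℕ} (h : i + m ≤ n + 1) :
    ∑ k ∈ Finset.range m, f (knot a b n (i + k))
      = ∑ k ∈ Finset.range m, f (a + (i + k) * mesh a b n) := by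
  refine Finset.sum_congr rfl fun k hk => ?_
  have := Finset.mem_range.1 hk
  rw [knot_of_mem a b n (by omega) (by omega)]
  push_cast
  rfl

theorem sum_midpt_eq (a b : ℝ) (f : ℝ → ℝ) {n m i : ℕ} (h0 : 2 ≤ i) (h : i + m ≤ n + 2) :
    ∑ k ∈ Finset.range m, f (midpt a b n (i + k))
      = ∑ k ∈ Finset.range m, f (a + (i - 3 / 2 + k) * mesh a b n) := by
  refine Finset.sum_congr rfl fun k hk => ?_
  have := Finset.mem_range.1 hk
  rw [midpt_of_mem a b n (by omega) (by omega)]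
  push_cast
  ring_nf

/-- With positions measured in cells from `a`, all nodes become explicit numbers, and comparing the
rule with a composite formula is an identity between rational weights. -/
theorem I2_eq_sum {a b : ℝ} (hab : a < b) (f : ℝ → ℝ) (m : ℕ) {F : ℝ → ℝ}
    (hF : ∀ t, F t = f (a + t * mesh a b (m + 4))) :
    I2 a b (m + 4) f = mesh a b (m + 4) * (∑ k ∈ Finset.range m, F (5 / 2 + k)
      + (1 / 9 * (F 0 + F (m + 4)) + 7 / 8 * (F (1 / 2) + F (m + 7 / 2))
        + 73 / 72 * (F (3 / 2) + F (m + 5 / 2)))) := by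
  have hs := sum_midpt_eq a b f (n := m + 4) (m := m) (i := 4) (by omega) (by omega)
  have h1 := midpt_last a b (n := m + 4) (by omega)
  have h2 := add_mul_mesh a b (n := m + 4) (by omega)
  push_cast at hs h1 h2
  rw [I2_eq hab, hs, midpt_first, show (m : ℤ) + 6 = m + 4 + 2 by ring, h1,
    midpt_of_mem a b _ (j := 2) (by omega) (by omega),
    midpt_of_mem a b _ (j := 3) (by omega) (by omega),
    midpt_of_mem a b _ (j := (m : ℤ) + 4) (by omega) (by omega),
    midpt_of_mem a b _ (j := (m : ℤ) + 5) (by omega) (by omega)]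
  simp only [hF]
  rw [h2]
  push_cast
  ring_nf

theorem I3_eq_sum {a b : ℝ} (hab : a < b) (f : ℝ → ℝ) (m : ℕ) {F : ℝ → ℝ}
    (hF : ∀ t, F t = f (a + t * mesh a b (m + 7))) :
    I3 a b (m + 7) f = mesh a b (m + 7) * (∑ k ∈ Finset.range m, F (4 + k)
      + (23 / 72 * (F 0 + F (m + 7)) + 4 / 3 * (F 1 + F (m + 6))
        + 19 / 24 * (F 2 + F (m + 5)) + 19 / 18 * (F 3 + F (m + 4)))) := by
  have hs := sum_knot_eq a b f (n := m + 7) (m := m) (i := 4) (by omega)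
  push_cast at hs
  rw [I3_eq hab, hs,
    knot_of_mem a b _ (i := 0) (by omega) (by omega),
    knot_of_mem a b _ (i := 1) (by omega) (by omega),
    knot_of_mem a b _ (i := 2) (by omega) (by omega),
    knot_of_mem a b _ (i := 3) (by omega) (by omega),
    knot_of_mem a b _ (i := (m : ℤ) + 4) (by omega) (by omega),
    knot_of_mem a b _ (i := (m : ℤ) + 5) (by omega) (by omega),
    knot_of_mem a b _ (i := (m : ℤ) + 6) (by omega) (by omega),
    knot_of_mem a b _ (i := (m : ℤ) + 7) (by omega) (by omega)]
  simp only [hF]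
  push_cast
  ring_nf

theorem I4_eq_sum {a b : ℝ} (hab : a < b) (f : ℝ → ℝ) (m : ℕ) {F : ℝ → ℝ}
    (hF : ∀ t, F t = f (a + t * mesh a b (m + 8))) :
    I4 a b (m + 8) f = mesh a b (m + 8) * (∑ k ∈ Finset.range m, F (9 / 2 + k)
      + (206 / 1575 * (F 0 + F (m + 8)) + 107 / 128 * (F (1 / 2) + F (m + 15 / 2))
        + 6019 / 5760 * (F (3 / 2) + F (m + 13 / 2))
        + 9467 / 9600 * (F (5 / 2) + F (m + 11 / 2))
        + 13469 / 13440 * (F (7 / 2) + F (m + 9 / 2)))) := by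
  have hs := sum_midpt_eq a b f (n := m + 8) (m := m) (i := 6) (by omega) (by omega)
  have h1 := midpt_last a b (n := m + 8) (by omega)
  have h2 := add_mul_mesh a b (n := m + 8) (by omega)
  push_cast at hs h1 h2
  rw [I4_eq hab, hs, midpt_first, show (m : ℤ) + 10 = m + 8 + 2 by ring, h1,
    midpt_of_mem a b _ (j := 2) (by omega) (by omega),
    midpt_of_mem a b _ (j := 3) (by omega) (by omega),
    midpt_of_mem a b _ (j := 4) (by omega) (by omega),
    midpt_of_mem a b _ (j := 5) (by omega) (by omega),
    midpt_of_mem a b _ (j := (m : ℤ) + 6) (by omega) (by omega),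
    midpt_of_mem a b _ (j := (m : ℤ) + 7) (by omega) (by omega),
    midpt_of_mem a b _ (j := (m : ℤ) + 8) (by omega) (by omega),
    midpt_of_mem a b _ (j := (m : ℤ) + 9) (by omega) (by omega)]
  simp only [hF]
  rw [h2]
  push_cast
  ring_nf

theorem I5_eq_sum {a b : ℝ} (hab : a < b) (f : ℝ → ℝ) (m : ℕ) {F : ℝ → ℝ}
    (hF : ∀ t, F t = f (a + t * mesh a b (m + 11))) :
    I5 a b (m + 11) f = mesh a b (m + 11) * (∑ k ∈ Finset.range m, F (6 + k)
      + (157 / 480 * (F 0 + F (m + 11)) + 961 / 720 * (F 1 + F (m + 10))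
        + 133 / 180 * (F 2 + F (m + 9)) + 271 / 240 * (F 3 + F (m + 8))
        + 1393 / 1440 * (F 4 + F (m + 7)) + 361 / 360 * (F 5 + F (m + 6)))) := by
  have hs := sum_knot_eq a b f (n := m + 11) (m := m) (i := 6) (by omega)
  push_cast at hs
  rw [I5_eq hab, hs,
    knot_of_mem a b _ (i := 0) (by omega) (by omega),
    knot_of_mem a b _ (i := 1) (by omega) (by omega),
    knot_of_mem a b _ (i := 2) (by omega) (by omega),
    knot_of_mem a b _ (i := 3) (by omega) (by omega),
    knot_of_mem a b _ (i := 4) (by omega) (by omega),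
    knot_of_mem a b _ (i := 5) (by omega) (by omega),
    knot_of_mem a b _ (i := (m : ℤ) + 6) (by omega) (by omega),
    knot_of_mem a b _ (i := (m : ℤ) + 7) (by omega) (by omega),
    knot_of_mem a b _ (i := (m : ℤ) + 8) (by omega) (by omega),
    knot_of_mem a b _ (i := (m : ℤ) + 9) (by omega) (by omega),
    knot_of_mem a b _ (i := (m : ℤ) + 10) (by omega) (by omega),
    knot_of_mem a b _ (i := (m : ℤ) + 11) (by omega) (by omega)]
  simp only [hF]
  push_cast
  ring_nf

theorem simpson_eq_sum (a b : ℝ) (f : ℝ → ℝ) (p : ℕ) {F : ℝ → ℝ}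
    (hF : ∀ t, F t = f (a + t * mesh a b (2 * p))) :
    simpson a b (2 * p) f = mesh a b (2 * p) / 3
      * ∑ k ∈ Finset.range p, (F (2 * k) + 4 * F (2 * k + 1) + F (2 * k + 2)) := by
  rw [simpson, show 2 * p / 2 = p by omega]
  congr 1
  refine Finset.sum_congr rfl fun k hk => ?_
  have := Finset.mem_range.1 hk
  rw [knot_of_mem a b _ (i := 2 * (k : ℤ)) (by omega) (by omega),
    knot_of_mem a b _ (i := 2 * (k : ℤ) + 1) (by omega) (by omega),
    knot_of_mem a b _ (i := 2 * (k : ℤ) + 2) (by omega) (by omega)]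
  simp only [hF]
  push_cast
  ring_nf

/-- The translates overlap and give each inner node total weight one. The incomplete weights at the
ends are what the end formula must supplement to obtain the rule. -/
theorem sum_stencil2 (F : ℝ → ℝ) (m : ℕ) :
    ∑ k ∈ Finset.range (m + 2),
      (1 / 24 * F (1 / 2 + k) + 11 / 12 * F (3 / 2 + k) + 1 / 24 * F (5 / 2 + k))
    = ∑ k ∈ Finset.range m, F (5 / 2 + k)
      + (1 / 24 * F (1 / 2) + 23 / 24 * F (3 / 2) + 23 / 24 * F (m + 5 / 2)
            + 1 / 24 * F (m + 7 / 2)) := by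
  induction m with
  | zero => simp [Finset.sum_range_succ]; ring_nf
  | succ m ih =>
    rw [show m + 1 + 2 = m + 2 + 1 by ring, Finset.sum_range_succ, ih,
      Finset.sum_range_succ]
    push_cast
    ring_nf

theorem exists_I2_error_bound {a b : ℝ} (hab : a < b) {f : ℝ → ℝ}
    (hf : ContDiffOn ℝ 3 f (Set.Icc a b)) :
    ∃ C : ℝ, ∀ n : ℕ, 4 ≤ n →
      |(∫ x in a..b, f x) - I2 a b n f| ≤ C * mesh a b n ^ 3 := by
  -- The interior formula integrates over one cell from its midpoint and the two neighbouring ones.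
  -- The end weights are those of the rule minus those in `sum_stencil2`: `1/9`, `7/8 - 1/24 = 5/6`
  -- and `73/72 - 23/24 = 1/18`.
  obtain ⟨C, hC⟩ := exists_composite_bound (q := 1) hab hf (s := 1) (r := 1 / 2)
    (L := 3 / 2) (lE := [(1 / 9, 0), (5 / 6, 1 / 2), (1 / 18, 3 / 2)])
    (lI := [(1 / 24, -1), (11 / 12, 0), (1 / 24, 1)])
    (by norm_num) (by norm_num) (by norm_num)
    (by intro k hk; interval_cases k <;> norm_num)
    (by intro k hk; interval_cases k <;> norm_num)
    (by simp; norm_num) (by simp; norm_num [abs_of_pos])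
  refine ⟨C, fun n hn => ?_⟩
  obtain ⟨m, rfl⟩ : ∃ m, n = m + 4 := ⟨n - 4, by omega⟩
  have h := hC (m + 4) (m + 2) (by omega)
    (by push_cast; linarith [Nat.cast_nonneg (α := ℝ) m]) (by push_cast; ring)
  convert h using 3
  obtain ⟨F, hF⟩ : ∃ F : ℝ → ℝ, ∀ t, F t = f (a + t * mesh a b (m + 4)) := ⟨_, fun _ => rfl⟩
  rw [I2_eq_sum hab f m hF]
  simp only [← hF, List.map_cons, List.map_nil, List.sum_cons, List.sum_nil]
  congr 1
  have hs := sum_stencil2 F m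
  ring_nf at hs ⊢
  rw [hs]
  push_cast
  ring_nf

theorem sum_stencil3 (F : ℝ → ℝ) (m : ℕ) :
    ∑ k ∈ Finset.range (m + 5),
      ((-1 / 24) * F (k) + 13 / 24 * F (1 + k) + 13 / 24 * F (2 + k) + (-1 / 24) * F (3 + k))
    = ∑ k ∈ Finset.range m, F (4 + k)
      + ((-1 / 24) * F (0) + 1 / 2 * F (1) + 25 / 24 * F (2) + 1 * F (3) + 1 * F (m + 4)
            + 25 / 24 * F (m + 5) + 1 / 2 * F (m + 6) + (-1 / 24) * F (m + 7)) := by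
  induction m with
  | zero => simp [Finset.sum_range_succ]; ring_nf
  | succ m ih =>
    rw [show m + 1 + 5 = m + 5 + 1 by ring, Finset.sum_range_succ, ih,
      Finset.sum_range_succ]
    push_cast
    ring_nf

theorem exists_I3_error_bound {a b : ℝ} (hab : a < b) {f : ℝ → ℝ}
    (hf : ContDiffOn ℝ 4 f (Set.Icc a b)) :
    ∃ C : ℝ, ∀ n : ℕ, 7 ≤ n →
      |(∫ x in a..b, f x) - I3 a b n f| ≤ C * mesh a b n ^ 4 := by
  -- The cell formula uses the four nearest knots and is exact for cubics. Subtracting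
  -- `sum_stencil3` from the rule leaves `23/72 + 1/24`, `4/3 - 1/2`, `19/24 - 25/24` and `19/18 -
  -- 1` for the end.
  obtain ⟨C, hC⟩ := exists_composite_bound (q := 2) hab hf (s := 1) (r := 1 / 2)
    (L := 3) (lE := [(13 / 36, 0), (5 / 6, 1), (-1 / 4, 2), (1 / 18, 3)])
    (lI := [(-1 / 24, -3 / 2), (13 / 24, -1 / 2), (13 / 24, 1 / 2), (-1 / 24, 3 / 2)])
    (by norm_num) (by norm_num) (by norm_num)
    (by intro k hk; interval_cases k <;> norm_num)
    (by intro k hk; interval_cases k <;> norm_num)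
    (by simp; norm_num) (by simp; norm_num [abs_of_pos])
  refine ⟨C, fun n hn => ?_⟩
  obtain ⟨m, rfl⟩ : ∃ m, n = m + 7 := ⟨n - 7, by omega⟩
  have h := hC (m + 7) (m + 5) (by omega)
    (by push_cast; linarith [Nat.cast_nonneg (α := ℝ) m]) (by push_cast; ring)
  convert h using 3
  obtain ⟨F, hF⟩ : ∃ F : ℝ → ℝ, ∀ t, F t = f (a + t * mesh a b (m + 7)) := ⟨_, fun _ => rfl⟩
  rw [I3_eq_sum hab f m hF]
  simp only [← hF, List.map_cons, List.map_nil, List.sum_cons, List.sum_nil]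
  congr 1
  have hs := sum_stencil3 F m
  ring_nf at hs ⊢
  rw [hs]
  push_cast
  ring_nf

theorem sum_stencil4 (F : ℝ → ℝ) (m : ℕ) :
    ∑ k ∈ Finset.range (m + 4),
      ((-17 / 5760) * F (1 / 2 + k) + 77 / 1440 * F (3 / 2 + k) + 863 / 960 * F (5 / 2 + k)
          + 77 / 1440 * F (7 / 2 + k) + (-17 / 5760) * F (9 / 2 + k))
    = ∑ k ∈ Finset.range m, F (9 / 2 + k)
      + ((-17 / 5760) * F (1 / 2) + 97 / 1920 * F (3 / 2) + 1823 / 1920 * F (5 / 2)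
            + 5777 / 5760 * F (7 / 2) + 5777 / 5760 * F (m + 9 / 2)
            + 1823 / 1920 * F (m + 11 / 2) + 97 / 1920 * F (m + 13 / 2)
            + (-17 / 5760) * F (m + 15 / 2)) := by
  induction m with
  | zero => simp [Finset.sum_range_succ]; ring_nf
  | succ m ih =>
    rw [show m + 1 + 4 = m + 4 + 1 by ring, Finset.sum_range_succ, ih,
      Finset.sum_range_succ]
    push_cast
    ring_nf

theorem exists_I4_error_bound {a b : ℝ} (hab : a < b) {f : ℝ → ℝ}
    (hf : ContDiffOn ℝ 5 f (Set.Icc a b)) :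
    ∃ C : ℝ, ∀ n : ℕ, 8 ≤ n →
      |(∫ x in a..b, f x) - I4 a b n f| ≤ C * mesh a b n ^ 5 := by
  -- The five-point formula reaches two cells beyond the midpoint of its own cell, so the first cell
  -- it can serve is the third one; hence `s = 2`. The end weights are again the rule minus
  -- `sum_stencil4`.
  obtain ⟨C, hC⟩ := exists_composite_bound (q := 3) hab hf (s := 2) (r := 1 / 2)
    (L := 7 / 2) (lE := [(206 / 1575, 0), (151 / 180, 1 / 2), (179 / 180, 3 / 2), (11 / 300, 5 / 2), (-1 / 1260, 7 / 2)])
    (lI := [(-17 / 5760, -2), (77 / 1440, -1), (863 / 960, 0), (77 / 1440, 1), (-17 / 5760, 2)])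
    (by norm_num) (by norm_num) (by norm_num)
    (by intro k hk; interval_cases k <;> norm_num)
    (by intro k hk; interval_cases k <;> norm_num)
    (by simp; norm_num) (by simp; norm_num [abs_of_pos])
  refine ⟨C, fun n hn => ?_⟩
  obtain ⟨m, rfl⟩ : ∃ m, n = m + 8 := ⟨n - 8, by omega⟩
  have h := hC (m + 8) (m + 4) (by omega)
    (by push_cast; linarith [Nat.cast_nonneg (α := ℝ) m]) (by push_cast; ring)
  convert h using 3
  obtain ⟨F, hF⟩ : ∃ F : ℝ → ℝ, ∀ t, F t = f (a + t * mesh a b (m + 8)) := ⟨_, fun _ => rfl⟩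
  rw [I4_eq_sum hab f m hF]
  simp only [← hF, List.map_cons, List.map_nil, List.sum_cons, List.sum_nil]
  congr 1
  have hs := sum_stencil4 F m
  ring_nf at hs ⊢
  rw [hs]
  push_cast
  ring_nf

/-- The formulas for `C ^ 5` are exact one degree further: the end formula to degree `4`, and the
interior one to degree `5`, where the odd moment vanishes by symmetry. So `q = 4` is admissible. -/
theorem exists_I4_error_bound_of_contDiffOn_six {a b : ℝ} (hab : a < b) {f : ℝ → ℝ}
    (hf : ContDiffOn ℝ 6 f (Set.Icc a b)) :
    ∃ C : ℝ, ∀ n : ℕ, 8 ≤ n →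
      |(∫ x in a..b, f x) - I4 a b n f| ≤ C * mesh a b n ^ 6 := by
  obtain ⟨C, hC⟩ := exists_composite_bound (q := 4) hab hf (s := 2) (r := 1 / 2)
    (L := 7 / 2) (lE := [(206 / 1575, 0), (151 / 180, 1 / 2), (179 / 180, 3 / 2), (11 / 300, 5 / 2), (-1 / 1260, 7 / 2)])
    (lI := [(-17 / 5760, -2), (77 / 1440, -1), (863 / 960, 0), (77 / 1440, 1), (-17 / 5760, 2)])
    (by norm_num) (by norm_num) (by norm_num)
    (by intro k hk; interval_cases k <;> norm_num)
    (by intro k hk; interval_cases k <;> norm_num)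
    (by simp; norm_num) (by simp; norm_num [abs_of_pos])
  refine ⟨C, fun n hn => ?_⟩
  obtain ⟨m, rfl⟩ : ∃ m, n = m + 8 := ⟨n - 8, by omega⟩
  have h := hC (m + 8) (m + 4) (by omega)
    (by push_cast; linarith [Nat.cast_nonneg (α := ℝ) m]) (by push_cast; ring)
  convert h using 3
  obtain ⟨F, hF⟩ : ∃ F : ℝ → ℝ, ∀ t, F t = f (a + t * mesh a b (m + 8)) := ⟨_, fun _ => rfl⟩
  rw [I4_eq_sum hab f m hF]
  simp only [← hF, List.map_cons, List.map_nil, List.sum_cons, List.sum_nil]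
  congr 1
  have hs := sum_stencil4 F m
  ring_nf at hs ⊢
  rw [hs]
  push_cast
  ring_nf

theorem sum_stencil5 (F : ℝ → ℝ) (m : ℕ) :
    ∑ k ∈ Finset.range (m + 7),
      (11 / 1440 * F (k) + (-31 / 480) * F (1 + k) + 401 / 720 * F (2 + k)
          + 401 / 720 * F (3 + k) + (-31 / 480) * F (4 + k) + 11 / 1440 * F (5 + k))
    = ∑ k ∈ Finset.range m, F (6 + k)
      + (11 / 1440 * F (0) + (-41 / 720) * F (1) + 1 / 2 * F (2) + 761 / 720 * F (3)
            + 1429 / 1440 * F (4) + 1 * F (5) + 1 * F (m + 6) + 1429 / 1440 * F (m + 7)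
            + 761 / 720 * F (m + 8) + 1 / 2 * F (m + 9) + (-41 / 720) * F (m + 10)
            + 11 / 1440 * F (m + 11)) := by
  induction m with
  | zero => simp [Finset.sum_range_succ]; ring_nf
  | succ m ih =>
    rw [show m + 1 + 7 = m + 7 + 1 by ring, Finset.sum_range_succ, ih,
      Finset.sum_range_succ]
    push_cast
    ring_nf

theorem exists_I5_error_bound {a b : ℝ} (hab : a < b) {f : ℝ → ℝ}
    (hf : ContDiffOn ℝ 6 f (Set.Icc a b)) :
    ∃ C : ℝ, ∀ n : ℕ, 11 ≤ n →
      |(∫ x in a..b, f x) - I5 a b n f| ≤ C * mesh a b n ^ 6 := by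
  -- The six-knot formula for the third cell uses the knots `0, …, 5`, hence `s = 2`. The end
  -- weights are the rule minus `sum_stencil5`, for instance `157/480 - 11/1440 = 23/72`.
  obtain ⟨C, hC⟩ := exists_composite_bound (q := 4) hab hf (s := 2) (r := 1 / 2)
    (L := 5) (lE := [(23 / 72, 0), (167 / 120, 1), (43 / 180, 2), (13 / 180, 3), (-1 / 40, 4), (1 / 360, 5)])
    (lI := [(11 / 1440, -5 / 2), (-31 / 480, -3 / 2), (401 / 720, -1 / 2), (401 / 720, 1 / 2), (-31 / 480, 3 / 2), (11 / 1440, 5 / 2)])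
    (by norm_num) (by norm_num) (by norm_num)
    (by intro k hk; interval_cases k <;> norm_num)
    (by intro k hk; interval_cases k <;> norm_num)
    (by simp; norm_num) (by simp; norm_num [abs_of_pos])
  refine ⟨C, fun n hn => ?_⟩
  obtain ⟨m, rfl⟩ : ∃ m, n = m + 11 := ⟨n - 11, by omega⟩
  have h := hC (m + 11) (m + 7) (by omega)
    (by push_cast; linarith [Nat.cast_nonneg (α := ℝ) m]) (by push_cast; ring)
  convert h using 3
  obtain ⟨F, hF⟩ : ∃ F : ℝ → ℝ, ∀ t, F t = f (a + t * mesh a b (m + 11)) := ⟨_, fun _ => rfl⟩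
  rw [I5_eq_sum hab f m hF]
  simp only [← hF, List.map_cons, List.map_nil, List.sum_cons, List.sum_nil]
  congr 1
  have hs := sum_stencil5 F m
  ring_nf at hs ⊢
  rw [hs]
  push_cast
  ring_nf

/-! ### The extrapolated rule -/

theorem sum_stencil_extrapolation (F : ℝ → ℝ) (m : ℕ) :
    ∑ k ∈ Finset.range m,
      ((-2 / 495) * F (1 / 2 + 2 * k) + 2 / 55 * F (3 / 2 + 2 * k) + 23 / 165 * F (2 + 2 * k)
          + 272 / 495 * F (5 / 2 + 2 * k) + 92 / 165 * F (3 + 2 * k)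
          + 272 / 495 * F (7 / 2 + 2 * k) + 23 / 165 * F (4 + 2 * k)
          + 2 / 55 * F (9 / 2 + 2 * k) + (-2 / 495) * F (11 / 2 + 2 * k))
    = 32 / 55 * ∑ k ∈ Finset.range (2 * m), F (5 / 2 + k)
      + 23 / 165 * ∑ k ∈ Finset.range (m + 2), (F (2 * k) + 4 * F (2 * k + 1) + F (2 * k + 2))
      + ((-23 / 165) * F (0) + (-2 / 495) * F (1 / 2) + (-92 / 165) * F (1)
            + 2 / 55 * F (3 / 2) + (-23 / 165) * F (2) + (-2 / 55) * F (5 / 2)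
            + 2 / 495 * F (7 / 2) + 2 / 495 * F (2 * m + 1 / 2) + (-2 / 55) * F (2 * m + 3 / 2)
            + (-23 / 165) * F (2 * m + 2) + 2 / 55 * F (2 * m + 5 / 2)
            + (-92 / 165) * F (2 * m + 3) + (-2 / 495) * F (2 * m + 7 / 2)
            + (-23 / 165) * F (2 * m + 4)) := by
  induction m with
  | zero => simp [Finset.sum_range_succ]; ring_nf
  | succ m ih =>
    rw [show m + 1 + 2 = m + 2 + 1 by ring, show 2 * (m + 1) = 2 * m + 1 + 1 by ring,
      Finset.sum_range_succ, ih, Finset.sum_range_succ _ (2 * m + 1),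
      Finset.sum_range_succ _ (2 * m), Finset.sum_range_succ _ (m + 2)]
    push_cast
    ring_nf

/-- Neither the quadratic rule nor Simpson's rule integrates quartics exactly in the interior, but
their combination with weights `32/55` and `23/55` does. -/
theorem exists_extrapolation_error_bound {a b : ℝ} (hab : a < b) {f : ℝ → ℝ}
    (hf : ContDiffOn ℝ 5 f (Set.Icc a b)) :
    ∃ C : ℝ, ∀ n : ℕ, 4 ≤ n → Even n →
      |(∫ x in a..b, f x) - 1 / 55 * (32 * I2 a b n f + 23 * simpson a b n f)|
        ≤ C * mesh a b n ^ 5 := by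
  -- Blocks of two cells centred at odd knots match Simpson's panels, whose weights become `23/165,
  -- 92/165, 23/165`. The weights at distance `3/2` and `5/2` overlap the neighbouring blocks; they
  -- keep the total `32/55` at every inner midpoint and leave an end formula exact for cubics. The
  -- node `0` is listed twice, with `32/55 * 1/9` and `23/55 * 1/3`.
  obtain ⟨C, hC⟩ := exists_composite_bound (q := 3) hab hf (s := 2) (r := 1) (L := 7 / 2)
    (lE := [(32 / 495, 0), (254 / 495, 1 / 2), (274 / 495, 3 / 2), (2 / 55, 5 / 2), (-2 / 495, 7 / 2), (23 / 165, 0), (92 / 165, 1), (23 / 165, 2)])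
    (lI := [(-2 / 495, -5 / 2), (2 / 55, -3 / 2), (23 / 165, -1), (272 / 495, -1 / 2), (92 / 165, 0), (272 / 495, 1 / 2), (23 / 165, 1), (2 / 55, 3 / 2), (-2 / 495, 5 / 2)])
    (by norm_num) (by norm_num) (by norm_num)
    (by intro k hk; interval_cases k <;> norm_num)
    (by intro k hk; interval_cases k <;> norm_num)
    (by simp; norm_num) (by simp; norm_num [abs_of_pos])
  refine ⟨C, fun n hn he => ?_⟩
  obtain ⟨m, rfl⟩ : ∃ m, n = 2 * m + 4 := by
    obtain ⟨p, rfl⟩ := he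
    exact ⟨p - 2, by omega⟩
  have h := hC (2 * m + 4) m (by omega)
    (by push_cast; linarith [Nat.cast_nonneg (α := ℝ) m]) (by push_cast; ring)
  convert h using 3
  obtain ⟨F, hF⟩ : ∃ F : ℝ → ℝ, ∀ t, F t = f (a + t * mesh a b (2 * m + 4)) := ⟨_, fun _ => rfl⟩
  have hS := simpson_eq_sum a b f (m + 2) (F := F) hF
  rw [show 2 * (m + 2) = 2 * m + 4 by ring] at hS
  rw [I2_eq_sum hab f (2 * m) hF, hS]
  simp only [← hF, List.map_cons, List.map_nil, List.sum_cons, List.sum_nil]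
  have hs := sum_stencil_extrapolation F m
  ring_nf at hs ⊢
  rw [hs]
  push_cast
  ring_nf

/-! ### Error formulas by Peano kernels -/

theorem integral_sub_pow (x u v : ℝ) (k : ℕ) :
    ∫ t in u..v, (x - t) ^ k = ((x - u) ^ (k + 1) - (x - v) ^ (k + 1)) / (k + 1) := by
  rw [intervalIntegral.integral_comp_sub_left (fun t => t ^ k), integral_pow]

/-- Bounds for an integral with a nonnegative kernel. -/
theorem kernel_bounds {K D : ℝ → ℝ} (hK : Continuous K) (hD : Continuous D) {u v m M : ℝ}
    (huv : u ≤ v) (hK0 : ∀ t ∈ Set.Icc u v, 0 ≤ K t)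
    (hm : ∀ t ∈ Set.Icc u v, m ≤ D t ∧ D t ≤ M) :
    m * (∫ t in u..v, K t) ≤ ∫ t in u..v, K t * D t ∧
      ∫ t in u..v, K t * D t ≤ M * ∫ t in u..v, K t := by
  rw [← intervalIntegral.integral_const_mul, ← intervalIntegral.integral_const_mul]
  constructor
  · refine intervalIntegral.integral_mono_on huv
      ((hK.const_mul m).intervalIntegrable _ _) ((hK.mul hD).intervalIntegrable _ _) fun t ht => ?_
    nlinarith [hK0 t ht, (hm t ht).1]
  · refine intervalIntegral.integral_mono_on huv
      ((hK.mul hD).intervalIntegrable _ _) ((hK.const_mul M).intervalIntegrable _ _) fun t ht => ?_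
    nlinarith [hK0 t ht, (hm t ht).2]

theorem iteratedDeriv_iteratedDeriv (g : ℝ → ℝ) (j k : ℕ) :
    iteratedDeriv k (iteratedDeriv j g) = iteratedDeriv (k + j) g := by
  simp only [iteratedDeriv_eq_iterate, Function.iterate_add_apply]

theorem contDiff_iteratedDeriv {g : ℝ → ℝ} {j k : ℕ} (hg : ContDiff ℝ (k + j : ℕ) g) :
    ContDiff ℝ k (iteratedDeriv j g) := by
  rw [contDiff_nat_iff_iteratedDeriv] at hg ⊢
  refine ⟨fun i hi => ?_, fun i hi => ?_⟩
  · rw [iteratedDeriv_iteratedDeriv]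
    exact hg.1 _ (by omega)
  · rw [iteratedDeriv_iteratedDeriv]
    exact hg.2 _ (by omega)

/-- The values of `g`, `g'`, `g'''` and the integral of `g` are all expanded about `0` with a
remainder in the fourth derivative. A functional that vanishes on cubics thereby becomes a single
integral of a kernel against that derivative. -/
theorem taylor_three {g : ℝ → ℝ} (hg : ContDiff ℝ 4 g) (x : ℝ) :
    g x = g 0 + iteratedDeriv 1 g 0 * x + iteratedDeriv 2 g 0 * x ^ 2 / 2
      + iteratedDeriv 3 g 0 * x ^ 3 / 6
      + ∫ t in (0 : ℝ)..x, (x - t) ^ 3 / 6 * iteratedDeriv 4 g t := by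
  have h := taylor_integral (m := 3) (by exact_mod_cast hg) 0 x
  norm_num [Finset.sum_range_succ, Nat.factorial] at h
  rw [h]
  norm_num
  ring

theorem taylor_three_deriv {g : ℝ → ℝ} (hg : ContDiff ℝ 4 g) (x : ℝ) :
    iteratedDeriv 1 g x = iteratedDeriv 1 g 0 + iteratedDeriv 2 g 0 * x
      + iteratedDeriv 3 g 0 * x ^ 2 / 2
      + ∫ t in (0 : ℝ)..x, (x - t) ^ 2 / 2 * iteratedDeriv 4 g t := by
  have h := taylor_integral (m := 2) (contDiff_iteratedDeriv (j := 1) (by exact_mod_cast hg)) 0 x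
  simp only [iteratedDeriv_iteratedDeriv, Finset.sum_range_succ, Nat.factorial] at h
  norm_num at h
  norm_num
  linarith

theorem taylor_three_deriv_three {g : ℝ → ℝ} (hg : ContDiff ℝ 4 g) (x : ℝ) :
    iteratedDeriv 3 g x = iteratedDeriv 3 g 0 + ∫ t in (0 : ℝ)..x, iteratedDeriv 4 g t := by
  have h := taylor_integral (m := 0) (contDiff_iteratedDeriv (j := 3) (by exact_mod_cast hg)) 0 x
  simp only [iteratedDeriv_iteratedDeriv, zero_add, Finset.sum_range_one, pow_zero,
    Nat.factorial_zero, Nat.cast_one, div_one, mul_one, one_mul, Nat.reduceAdd] at h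
  exact h

/-- This is the expansion to degree `4` of the primitive of `g`, whose fifth derivative is the
fourth derivative of `g`. -/
theorem taylor_three_integral {g : ℝ → ℝ} (hg : ContDiff ℝ 4 g) (x : ℝ) :
    ∫ t in (0 : ℝ)..x, g t = g 0 * x + iteratedDeriv 1 g 0 * x ^ 2 / 2
      + iteratedDeriv 2 g 0 * x ^ 3 / 6 + iteratedDeriv 3 g 0 * x ^ 4 / 24
      + ∫ t in (0 : ℝ)..x, (x - t) ^ 4 / 24 * iteratedDeriv 4 g t := by
  set G : ℝ → ℝ := fun x => ∫ t in (0 : ℝ)..x, g t with hG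
  have hder : ∀ x, HasDerivAt G (g x) x := fun x =>
    (hg.continuous.integral_hasStrictDerivAt 0 x).hasDerivAt
  have hdG : deriv G = g := funext fun x => (hder x).deriv
  have hGc : ContDiff ℝ (4 + 1) G := by
    rw [contDiff_succ_iff_deriv]
    exact ⟨fun x => (hder x).differentiableAt, by simp, by rwa [hdG]⟩
  have h := taylor_integral (m := 4) (by exact_mod_cast hGc) 0 x
  have h0 : G 0 = 0 := by simp [hG]
  simp only [Finset.sum_range_succ, Finset.sum_range_zero, iteratedDeriv_succ', hdG,
    iteratedDeriv_zero, h0, Nat.factorial] at h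
  rw [show ∫ t in (0 : ℝ)..x, g t = G x from rfl, h]
  simp only [iteratedDeriv_succ', iteratedDeriv_zero]
  norm_num
  ring

/-- The corrected midpoint rule on half a cell. -/
theorem midpoint_half_bounds {g : ℝ → ℝ} (hg : ContDiff ℝ 4 g) {m M : ℝ}
    (hD : ∀ t ∈ Set.Icc (0 : ℝ) (1 / 2), m ≤ iteratedDeriv 4 g t ∧ iteratedDeriv 4 g t ≤ M) :
    23 / 11520 * m ≤ (∫ t in (0 : ℝ)..(1 / 2), g t) - g 0 / 2 - iteratedDeriv 1 g (1 / 2) / 24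
        + iteratedDeriv 3 g (1 / 2) / 192 - iteratedDeriv 1 g 0 / 12
        - iteratedDeriv 3 g 0 / 384 ∧
    (∫ t in (0 : ℝ)..(1 / 2), g t) - g 0 / 2 - iteratedDeriv 1 g (1 / 2) / 24
        + iteratedDeriv 3 g (1 / 2) / 192 - iteratedDeriv 1 g 0 / 12
        - iteratedDeriv 3 g 0 / 384 ≤ 23 / 11520 * M := by
  have hDc : Continuous (iteratedDeriv 4 g) := hg.continuous_iteratedDeriv 4 le_rfl
  -- The three terms are the remainders of the integral, of `g'(1/2) / 24` and of `g'''(1/2) / 192`.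
  -- The derivatives at `0` make the functional vanish on cubics and cancel when the reflected
  -- half-cell is added.
  set K : ℝ → ℝ := fun t => 1 / 24 * (1 / 2 - t) ^ 4 - 1 / 48 * (1 / 2 - t) ^ 2
    + 1 / 192 * (1 / 2 - t) ^ 0 with hK
  have hKc : Continuous K := by fun_prop
  have hKi : ∫ t in (0 : ℝ)..(1 / 2), K t = 23 / 11520 := by
    rw [hK, intervalIntegral.integral_add, intervalIntegral.integral_sub]
    · simp only [intervalIntegral.integral_const_mul, integral_sub_pow]
      norm_num
    all_goals exact Continuous.intervalIntegrable (by fun_prop) _ _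
  have key : (∫ t in (0 : ℝ)..(1 / 2), g t) - g 0 / 2 - iteratedDeriv 1 g (1 / 2) / 24
        + iteratedDeriv 3 g (1 / 2) / 192 - iteratedDeriv 1 g 0 / 12 - iteratedDeriv 3 g 0 / 384
      = ∫ t in (0 : ℝ)..(1 / 2), K t * iteratedDeriv 4 g t := by
    have e : ∫ t in (0 : ℝ)..(1 / 2), K t * iteratedDeriv 4 g t
        = (∫ t in (0 : ℝ)..(1 / 2), (1 / 2 - t) ^ 4 / 24 * iteratedDeriv 4 g t)
          - 1 / 24 * (∫ t in (0 : ℝ)..(1 / 2), (1 / 2 - t) ^ 2 / 2 * iteratedDeriv 4 g t)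
          + 1 / 192 * ∫ t in (0 : ℝ)..(1 / 2), iteratedDeriv 4 g t := by
      rw [← intervalIntegral.integral_const_mul, ← intervalIntegral.integral_const_mul,
        ← intervalIntegral.integral_sub, ← intervalIntegral.integral_add]
      · refine intervalIntegral.integral_congr fun t _ => ?_
        simp only [hK]
        ring
      all_goals exact Continuous.intervalIntegrable (by fun_prop) _ _
    rw [e, taylor_three_integral hg, taylor_three_deriv hg (1 / 2),
      taylor_three_deriv_three hg (1 / 2)]
    ring
  -- With `s = 1/2 - t` the kernel is `((s ^ 2 - 1/4) ^ 2 + 1/16) / 24`.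
  have hb := kernel_bounds hKc hDc (u := 0) (v := 1 / 2) (by norm_num) (fun t _ => by
    simp only [hK]
    nlinarith [sq_nonneg ((1 / 2 - t) ^ 2 - 1 / 4)]) hD
  rw [key]
  rw [hKi] at hb
  constructor <;> linarith [hb.1, hb.2]

/-- The boundary correction of the quadratic rule. -/
theorem boundary_bounds {g : ℝ → ℝ} (hg : ContDiff ℝ 4 g) {m M : ℝ}
    (hD : ∀ t ∈ Set.Icc (0 : ℝ) (3 / 2), m ≤ iteratedDeriv 4 g t ∧ iteratedDeriv 4 g t ≤ M) :
    1 / 384 * m ≤ 1 / 9 * g 0 - 1 / 8 * g (1 / 2) + 1 / 72 * g (3 / 2)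
        + iteratedDeriv 1 g 0 / 24 - iteratedDeriv 3 g 0 / 192 ∧
    1 / 9 * g 0 - 1 / 8 * g (1 / 2) + 1 / 72 * g (3 / 2)
        + iteratedDeriv 1 g 0 / 24 - iteratedDeriv 3 g 0 / 192 ≤ 1 / 384 * M := by
  have hDc : Continuous (iteratedDeriv 4 g) := hg.continuous_iteratedDeriv 4 le_rfl
  -- The values at `3/2` and `1/2` contribute `1/72 * 1/6` and `-1/8 * 1/6` times truncated cubes,
  -- and the second vanishes beyond `1/2`. The weights `-1/8` and `1/72` are `7/8 - 1` and `73/72 -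
  -- 1`, the excess of the rule over the midpoint rule.
  set K₁ : ℝ → ℝ := fun t => 1 / 432 * (3 / 2 - t) ^ 3 - 1 / 48 * (1 / 2 - t) ^ 3 with hK₁
  set K₂ : ℝ → ℝ := fun t => 1 / 432 * (3 / 2 - t) ^ 3 with hK₂
  have hKc₁ : Continuous K₁ := by fun_prop
  have hKc₂ : Continuous K₂ := by fun_prop
  have hKi₁ : ∫ t in (0 : ℝ)..(1 / 2), K₁ t = 1 / 432 * (65 / 64) - 1 / 3072 := by
    rw [hK₁, intervalIntegral.integral_sub]
    · simp only [intervalIntegral.integral_const_mul, integral_sub_pow]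
      norm_num
    all_goals exact Continuous.intervalIntegrable (by fun_prop) _ _
  have hKi₂ : ∫ t in (1 / 2 : ℝ)..(3 / 2), K₂ t = 1 / 1728 := by
    simp only [hK₂, intervalIntegral.integral_const_mul, integral_sub_pow]
    norm_num
  have key : 1 / 9 * g 0 - 1 / 8 * g (1 / 2) + 1 / 72 * g (3 / 2)
        + iteratedDeriv 1 g 0 / 24 - iteratedDeriv 3 g 0 / 192
      = (∫ t in (0 : ℝ)..(1 / 2), K₁ t * iteratedDeriv 4 g t)
        + ∫ t in (1 / 2 : ℝ)..(3 / 2), K₂ t * iteratedDeriv 4 g t := by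
    have e₁ : ∫ t in (0 : ℝ)..(1 / 2), K₁ t * iteratedDeriv 4 g t
        = (∫ t in (0 : ℝ)..(1 / 2), K₂ t * iteratedDeriv 4 g t)
          - 1 / 8 * ∫ t in (0 : ℝ)..(1 / 2), (1 / 2 - t) ^ 3 / 6 * iteratedDeriv 4 g t := by
      rw [← intervalIntegral.integral_const_mul, ← intervalIntegral.integral_sub]
      · refine intervalIntegral.integral_congr fun t _ => ?_
        simp only [hK₁, hK₂]
        ring
      all_goals exact Continuous.intervalIntegrable (by fun_prop) _ _
    have e₂ : (∫ t in (0 : ℝ)..(1 / 2), K₂ t * iteratedDeriv 4 g t)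
          + ∫ t in (1 / 2 : ℝ)..(3 / 2), K₂ t * iteratedDeriv 4 g t
        = 1 / 72 * ∫ t in (0 : ℝ)..(3 / 2), (3 / 2 - t) ^ 3 / 6 * iteratedDeriv 4 g t := by
      rw [intervalIntegral.integral_add_adjacent_intervals,
        ← intervalIntegral.integral_const_mul]
      · refine intervalIntegral.integral_congr fun t _ => ?_
        simp only [hK₂]
        ring
      all_goals exact Continuous.intervalIntegrable (by fun_prop) _ _
    rw [e₁, taylor_three hg (1 / 2), taylor_three hg (3 / 2)]
    linarith [e₂]
  have hb₁ := kernel_bounds hKc₁ hDc (u := 0) (v := 1 / 2) (m := m) (M := M) (by norm_num)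
    (fun t ht => by
      -- Positivity needs only the factor `9`, while `3/2 - t ≥ 3 * (1/2 - t)` gives `27`.
      have h1 : 0 ≤ 1 / 2 - t := by linarith [ht.2]
      have h2 : (3 * (1 / 2 - t)) ^ 3 ≤ (3 / 2 - t) ^ 3 :=
        pow_le_pow_left₀ (by linarith) (by linarith [ht.1]) 3
      have h3 : 0 ≤ (1 / 2 - t) ^ 3 := by positivity
      simp only [hK₁]
      nlinarith)
    fun t ht => hD t ⟨ht.1, by linarith [ht.2]⟩
  have hb₂ := kernel_bounds hKc₂ hDc (u := 1 / 2) (v := 3 / 2) (m := m) (M := M) (by norm_num)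
    (fun t ht => by
      have h1 : 0 ≤ 3 / 2 - t := by linarith [ht.2]
      simp only [hK₂]
      positivity)
    fun t ht => hD t ⟨by linarith [ht.1], ht.2⟩
  rw [key]
  rw [hKi₁] at hb₁
  rw [hKi₂] at hb₂
  constructor <;> linarith [hb₁.1, hb₁.2, hb₂.1, hb₂.2]

/-- Simpson's rule on half of its interval. -/
theorem simpson_half_bounds {g : ℝ → ℝ} (hg : ContDiff ℝ 4 g) {m M : ℝ}
    (hD : ∀ t ∈ Set.Icc (0 : ℝ) 1, m ≤ iteratedDeriv 4 g t ∧ iteratedDeriv 4 g t ≤ M) :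
    1 / 180 * m ≤ 2 / 3 * g 0 + 1 / 3 * g 1 + iteratedDeriv 1 g 0 / 6
        - iteratedDeriv 3 g 0 / 72 - (∫ t in (0 : ℝ)..1, g t) ∧
    2 / 3 * g 0 + 1 / 3 * g 1 + iteratedDeriv 1 g 0 / 6
        - iteratedDeriv 3 g 0 / 72 - (∫ t in (0 : ℝ)..1, g t) ≤ 1 / 180 * M := by
  have hDc : Continuous (iteratedDeriv 4 g) := hg.continuous_iteratedDeriv 4 le_rfl
  set K : ℝ → ℝ := fun t => 1 / 18 * (1 - t) ^ 3 - 1 / 24 * (1 - t) ^ 4 with hK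
  have hKc : Continuous K := by fun_prop
  have hKi : ∫ t in (0 : ℝ)..1, K t = 1 / 180 := by
    rw [hK, intervalIntegral.integral_sub]
    · simp only [intervalIntegral.integral_const_mul, integral_sub_pow]
      norm_num
    all_goals exact Continuous.intervalIntegrable (by fun_prop) _ _
  have key : 2 / 3 * g 0 + 1 / 3 * g 1 + iteratedDeriv 1 g 0 / 6
        - iteratedDeriv 3 g 0 / 72 - (∫ t in (0 : ℝ)..1, g t)
      = ∫ t in (0 : ℝ)..1, K t * iteratedDeriv 4 g t := by
    have e : ∫ t in (0 : ℝ)..1, K t * iteratedDeriv 4 g t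
        = 1 / 3 * (∫ t in (0 : ℝ)..1, (1 - t) ^ 3 / 6 * iteratedDeriv 4 g t)
          - ∫ t in (0 : ℝ)..1, (1 - t) ^ 4 / 24 * iteratedDeriv 4 g t := by
      rw [← intervalIntegral.integral_const_mul, ← intervalIntegral.integral_sub]
      · refine intervalIntegral.integral_congr fun t _ => ?_
        simp only [hK]
        ring
      all_goals exact Continuous.intervalIntegrable (by fun_prop) _ _
    rw [e, taylor_three_integral hg, taylor_three hg 1]
    ring
  -- The kernel is `(1 - t) ^ 3 * (1 + 3 * t) / 72`.
  have hb := kernel_bounds hKc hDc (u := 0) (v := 1) (by norm_num) (fun t ht => by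
    have h1 : 0 ≤ 1 - t := by linarith [ht.2]
    have h2 : 0 ≤ (1 - t) ^ 3 := by positivity
    have h3 := mul_nonneg h2 ht.1
    simp only [hK]
    nlinarith) hD
  rw [key]
  rw [hKi] at hb
  constructor <;> linarith [hb.1, hb.2]

theorem iteratedDeriv_comp_affine {g : ℝ → ℝ} {k : ℕ} (hg : ContDiff ℝ k g) (c h u : ℝ) :
    iteratedDeriv k (fun u => g (c + h * u)) u = h ^ k * iteratedDeriv k g (c + h * u) := by
  have hs : ContDiff ℝ k fun z => g (c + z) := hg.comp (contDiff_const.add contDiff_id)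
  have h1 := congrFun (iteratedDeriv_comp_const_mul hs h) u
  rw [iteratedDeriv_comp_const_add] at h1
  exact h1

/-- The factor `h ^ 4` is nonnegative for either sign of `h`, so the bounds keep their order under
reflection. -/
theorem fourth_deriv_affine_bounds {g : ℝ → ℝ} (hg : ContDiff ℝ 4 g) {m M c h : ℝ} {s : Set ℝ}
    (hD : ∀ u ∈ s, m ≤ iteratedDeriv 4 g (c + h * u) ∧ iteratedDeriv 4 g (c + h * u) ≤ M) :
    ∀ u ∈ s, h ^ 4 * m ≤ iteratedDeriv 4 (fun u => g (c + h * u)) u ∧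
      iteratedDeriv 4 (fun u => g (c + h * u)) u ≤ h ^ 4 * M := by
  intro u hu
  rw [iteratedDeriv_comp_affine (by exact_mod_cast hg)]
  have : 0 ≤ h ^ 4 := by positivity
  exact ⟨mul_le_mul_of_nonneg_left (hD u hu).1 this, mul_le_mul_of_nonneg_left (hD u hu).2 this⟩

/-- The midpoint rule on a cell, with derivative corrections. -/
theorem midpoint_bounds {g : ℝ → ℝ} (hg : ContDiff ℝ 4 g) {m M c h : ℝ} (hh : 0 < h)
    (hD : ∀ t ∈ Set.Icc (c - h / 2) (c + h / 2),
      m ≤ iteratedDeriv 4 g t ∧ iteratedDeriv 4 g t ≤ M) :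
    23 / 5760 * h ^ 5 * m ≤ (∫ t in (c - h / 2)..(c + h / 2), g t) - h * g c
        - h ^ 2 / 24 * (iteratedDeriv 1 g (c + h / 2) - iteratedDeriv 1 g (c - h / 2))
        + h ^ 4 / 192 * (iteratedDeriv 3 g (c + h / 2) - iteratedDeriv 3 g (c - h / 2)) ∧
    (∫ t in (c - h / 2)..(c + h / 2), g t) - h * g c
        - h ^ 2 / 24 * (iteratedDeriv 1 g (c + h / 2) - iteratedDeriv 1 g (c - h / 2))
        + h ^ 4 / 192 * (iteratedDeriv 3 g (c + h / 2) - iteratedDeriv 3 g (c - h / 2))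
      ≤ 23 / 5760 * h ^ 5 * M := by
  have hc : ∀ s : ℝ, ContDiff ℝ 4 fun u => g (c + s * u) := fun s => by fun_prop
  have h1 : ContDiff ℝ (1 : ℕ) g := hg.of_le (by norm_num)
  have h3 : ContDiff ℝ (3 : ℕ) g := hg.of_le (by norm_num)
  have b₁ := midpoint_half_bounds (hc h) (fourth_deriv_affine_bounds hg (m := m) (M := M)
    fun u hu => hD _ ⟨by nlinarith [hu.1], by nlinarith [hu.2]⟩)
  -- The left half is the reflected right half. Odd derivatives change sign: those at `c` cancel,
  -- and those at the two ends of the cell form differences.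
  have b₂ := midpoint_half_bounds (hc (-h)) (fourth_deriv_affine_bounds hg (m := m) (M := M)
    fun u hu => hD _ ⟨by nlinarith [hu.2], by nlinarith [hu.1]⟩)
  simp only [iteratedDeriv_comp_affine h1, iteratedDeriv_comp_affine h3] at b₁ b₂
  have i₁ := intervalIntegral.mul_integral_comp_add_mul (a := 0) (b := 1 / 2) (f := g) h c
  have i₂ := intervalIntegral.mul_integral_comp_add_mul (a := 0) (b := 1 / 2) (f := g) (-h) c
  rw [mul_zero, add_zero, show c + h * (1 / 2) = c + h / 2 by ring] at i₁
  rw [mul_zero, add_zero, show c + -h * (1 / 2) = c - h / 2 by ring,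
    intervalIntegral.integral_symm (c - h / 2) c] at i₂
  rw [← intervalIntegral.integral_add_adjacent_intervals
    (hg.continuous.intervalIntegrable (c - h / 2) c)
    (hg.continuous.intervalIntegrable c (c + h / 2))]
  rw [show c + h * (1 / 2) = c + h / 2 by ring] at b₁
  rw [show c + -h * (1 / 2) = c - h / 2 by ring] at b₂
  simp only [mul_zero, add_zero] at b₁ b₂
  have c₁ := mul_le_mul_of_nonneg_left b₁.1 hh.le
  have c₂ := mul_le_mul_of_nonneg_left b₁.2 hh.le
  have c₃ := mul_le_mul_of_nonneg_left b₂.1 hh.le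
  have c₄ := mul_le_mul_of_nonneg_left b₂.2 hh.le
  constructor <;> linarith [i₁, i₂]

/-- The boundary correction of the quadratic rule at scale `h`, which is negative at the right
endpoint. -/
theorem boundary_bounds_affine {g : ℝ → ℝ} (hg : ContDiff ℝ 4 g) {m M c h : ℝ}
    (hD : ∀ u ∈ Set.Icc (0 : ℝ) (3 / 2),
      m ≤ iteratedDeriv 4 g (c + h * u) ∧ iteratedDeriv 4 g (c + h * u) ≤ M) :
    1 / 384 * (h ^ 4 * m) ≤ 1 / 9 * g c - 1 / 8 * g (c + h * (1 / 2))
        + 1 / 72 * g (c + h * (3 / 2)) + h * iteratedDeriv 1 g c / 24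
        - h ^ 3 * iteratedDeriv 3 g c / 192 ∧
    1 / 9 * g c - 1 / 8 * g (c + h * (1 / 2))
        + 1 / 72 * g (c + h * (3 / 2)) + h * iteratedDeriv 1 g c / 24
        - h ^ 3 * iteratedDeriv 3 g c / 192 ≤ 1 / 384 * (h ^ 4 * M) := by
  have hc : ContDiff ℝ 4 fun u => g (c + h * u) := by fun_prop
  have h1 : ContDiff ℝ (1 : ℕ) g := hg.of_le (by norm_num)
  have h3 : ContDiff ℝ (3 : ℕ) g := hg.of_le (by norm_num)
  have b := boundary_bounds hc (fourth_deriv_affine_bounds hg hD)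
  simpa only [iteratedDeriv_comp_affine h1, iteratedDeriv_comp_affine h3, mul_zero, add_zero,
    pow_one] using b

/-- Simpson's rule. -/
theorem simpson_bounds {g : ℝ → ℝ} (hg : ContDiff ℝ 4 g) {m M c h : ℝ} (hh : 0 < h)
    (hD : ∀ t ∈ Set.Icc (c - h) (c + h), m ≤ iteratedDeriv 4 g t ∧ iteratedDeriv 4 g t ≤ M) :
    1 / 90 * h ^ 5 * m ≤ h / 3 * (g (c - h) + 4 * g c + g (c + h))
        - (∫ t in (c - h)..(c + h), g t) ∧
    h / 3 * (g (c - h) + 4 * g c + g (c + h)) - (∫ t in (c - h)..(c + h), g t)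
      ≤ 1 / 90 * h ^ 5 * M := by
  have hc : ∀ s : ℝ, ContDiff ℝ 4 fun u => g (c + s * u) := fun s => by fun_prop
  have h1 : ContDiff ℝ (1 : ℕ) g := hg.of_le (by norm_num)
  have h3 : ContDiff ℝ (3 : ℕ) g := hg.of_le (by norm_num)
  have b₁ := simpson_half_bounds (hc h) (fourth_deriv_affine_bounds hg (m := m) (M := M)
    fun u hu => hD _ ⟨by nlinarith [hu.1], by nlinarith [hu.2]⟩)
  have b₂ := simpson_half_bounds (hc (-h)) (fourth_deriv_affine_bounds hg (m := m) (M := M)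
    fun u hu => hD _ ⟨by nlinarith [hu.2], by nlinarith [hu.1]⟩)
  simp only [iteratedDeriv_comp_affine h1, iteratedDeriv_comp_affine h3] at b₁ b₂
  have i₁ := intervalIntegral.mul_integral_comp_add_mul (a := 0) (b := 1) (f := g) h c
  have i₂ := intervalIntegral.mul_integral_comp_add_mul (a := 0) (b := 1) (f := g) (-h) c
  rw [mul_zero, add_zero, mul_one] at i₁
  rw [mul_zero, add_zero, mul_one, ← sub_eq_add_neg,
    intervalIntegral.integral_symm (c - h) c] at i₂
  rw [← intervalIntegral.integral_add_adjacent_intervals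
    (hg.continuous.intervalIntegrable (c - h) c)
    (hg.continuous.intervalIntegrable c (c + h))]
  simp only [mul_zero, add_zero, mul_one, ← sub_eq_add_neg] at b₁ b₂
  have c₁ := mul_le_mul_of_nonneg_left b₁.1 hh.le
  have c₂ := mul_le_mul_of_nonneg_left b₁.2 hh.le
  have c₃ := mul_le_mul_of_nonneg_left b₂.1 hh.le
  have c₄ := mul_le_mul_of_nonneg_left b₂.2 hh.le
  constructor <;> linarith [i₁, i₂]

/-! ### Error formulas with intermediate points -/

/-- Bounds `m`, `M` of a continuous function that are sharp in the sense of the intermediate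
value theorem. -/
theorem exists_sharp_bounds {a b : ℝ} (hab : a < b) {D : ℝ → ℝ} (hD : Continuous D) :
    ∃ m M : ℝ, (∀ t ∈ Set.Icc a b, m ≤ D t ∧ D t ≤ M) ∧
      ∀ A x : ℝ, 0 < A → A * m ≤ x → x ≤ A * M → ∃ c ∈ Set.Icc a b, x = A * D c := by
  have h := ContinuousOn.image_Icc hab.le (hD.continuousOn (s := Set.Icc a b))
  refine ⟨sInf (D '' Set.Icc a b), sSup (D '' Set.Icc a b), fun t ht => ?_, fun A x hA h1 h2 => ?_⟩
  · have := h ▸ Set.mem_image_of_mem D ht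
    exact this
  · have hx : x / A ∈ D '' Set.Icc a b := by
      rw [h]
      exact ⟨(le_div_iff₀' hA).2 h1, (div_le_iff₀' hA).2 h2⟩
    obtain ⟨c, hc, e⟩ := hx
    exact ⟨c, hc, by rw [e]; field_simp⟩

/-- A function of class `C⁴` on an interval, extended to the line. -/
theorem exists_extension_four {a b : ℝ} (hab : a < b) {f : ℝ → ℝ}
    (hf : ContDiffOn ℝ 4 f (Set.Icc a b)) :
    ∃ g : ℝ → ℝ, ContDiff ℝ 4 g ∧ Set.EqOn f g (Set.Icc a b) ∧
      ∀ c ∈ Set.Icc a b,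
        iteratedDerivWithin 4 f (Set.Icc a b) c = iteratedDeriv 4 g c := by
  obtain ⟨g, hg, hfg⟩ := exists_contDiff_extension hab 4 hf
  refine ⟨g, hg, hfg, fun c hc => ?_⟩
  rw [iteratedDerivWithin_congr hfg hc]
  exact iteratedDerivWithin_eq_iteratedDeriv (uniqueDiffOn_Icc hab) hg.contDiffAt hc

/-- The errors of all panels lie between the same multiples of the extreme values of the fourth
derivative, so a single intermediate point serves for their sum. -/
theorem simpson_error_formula {a b : ℝ} (hab : a < b) {f : ℝ → ℝ}
    (hf : ContDiffOn ℝ 4 f (Set.Icc a b)) {n : ℕ} (hn : 2 ≤ n) (he : Even n) :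
    ∃ c ∈ Set.Icc a b,
      (∫ x in a..b, f x) - simpson a b n f =
        -(1 / 180) * (b - a) * mesh a b n ^ 4 * iteratedDerivWithin 4 f (Set.Icc a b) c := by
  obtain ⟨p, rfl⟩ : ∃ p, n = 2 * p := by
    obtain ⟨p, rfl⟩ := he
    exact ⟨p, by ring⟩
  obtain ⟨g, hg, hfg, hder⟩ := exists_extension_four hab hf
  have hDc : Continuous (iteratedDeriv 4 g) := hg.continuous_iteratedDeriv 4 le_rfl
  obtain ⟨m, M, hb, hsharp⟩ := exists_sharp_bounds hab hDc
  obtain ⟨F, hF⟩ : ∃ F : ℝ → ℝ, ∀ t, F t = f (a + t * mesh a b (2 * p)) := ⟨_, fun _ => rfl⟩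
  have hnh := add_mul_mesh a b (n := 2 * p) (by omega)
  have hh := mesh_pos hab (n := 2 * p) (by omega)
  rw [simpson_eq_sum a b f p hF]
  set h := mesh a b (2 * p) with hh'
  push_cast at hnh
  have hint : ∫ x in a..b, f x
      = ∑ k ∈ Finset.range p, ∫ x in (a + (2 * k + 1) * h - h)..(a + (2 * k + 1) * h + h), g x := by
    have h2 := intervalIntegral.sum_integral_adjacent_intervals (μ := volume) (f := g)
      (a := fun k : ℕ => a + 2 * k * h) (n := p) fun k _ =>
        hg.continuous.intervalIntegrable _ _
    simp only [Nat.cast_zero, mul_zero, zero_mul, add_zero, hnh] at h2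
    rw [intervalIntegral.integral_congr (g := g) (by rwa [Set.uIcc_of_le hab.le]), ← h2]
    refine Finset.sum_congr rfl fun k _ => ?_
    congr 1
    · ring
    · push_cast; ring
  have hblock : ∀ k ∈ Finset.range p,
      1 / 90 * h ^ 5 * m ≤ h / 3 * (F (2 * k) + 4 * F (2 * k + 1) + F (2 * k + 2))
        - (∫ x in (a + (2 * k + 1) * h - h)..(a + (2 * k + 1) * h + h), g x) ∧
      h / 3 * (F (2 * k) + 4 * F (2 * k + 1) + F (2 * k + 2))
        - (∫ x in (a + (2 * k + 1) * h - h)..(a + (2 * k + 1) * h + h), g x)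
        ≤ 1 / 90 * h ^ 5 * M := by
    intro k hk
    have hk1 : (k : ℝ) + 1 ≤ p := by exact_mod_cast Finset.mem_range.1 hk
    have hk0 : (0 : ℝ) ≤ k := Nat.cast_nonneg k
    have hkh : (k : ℝ) * h + h ≤ p * h := by nlinarith
    have hkh0 : 0 ≤ (k : ℝ) * h := by positivity
    have hmem : ∀ t ∈ Set.Icc (a + (2 * k + 1) * h - h) (a + (2 * k + 1) * h + h),
        t ∈ Set.Icc a b := fun t ht => ⟨by linarith [ht.1], by linarith [ht.2]⟩
    have h1 := simpson_bounds hg hh fun t ht => hb t (hmem t ht)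
    rw [hF, hF, hF, hfg (hmem _ ⟨by linarith, by linarith⟩),
      hfg (hmem _ ⟨by linarith, by linarith⟩), hfg (hmem _ ⟨by linarith, by linarith⟩)]
    rw [show a + (2 * k + 1) * h - h = a + 2 * k * h by ring,
      show a + (2 * k + 1) * h + h = a + (2 * k + 2) * h by ring] at h1 ⊢
    exact h1
  have hlow := Finset.sum_le_sum fun k hk => (hblock k hk).1
  have hupp := Finset.sum_le_sum fun k hk => (hblock k hk).2
  simp only [Finset.sum_const, Finset.card_range, nsmul_eq_mul, Finset.sum_sub_distrib,
    ← Finset.mul_sum, ← hint] at hlow hupp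
  have hph : (p : ℝ) * h = (b - a) / 2 := by linarith
  have hA : (p : ℝ) * (1 / 90 * h ^ 5) = 1 / 180 * (b - a) * h ^ 4 := by
    linear_combination 1 / 90 * h ^ 4 * hph
  obtain ⟨c, hc, e⟩ := hsharp (1 / 180 * (b - a) * h ^ 4)
    (h / 3 * ∑ k ∈ Finset.range p, (F (2 * k) + 4 * F (2 * k + 1) + F (2 * k + 2))
      - ∫ x in a..b, f x) (mul_pos (mul_pos (by norm_num) (by linarith)) (by positivity))
    (by rw [← hA]; linarith [hlow])
    (by rw [← hA]; linarith [hupp])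
  exact ⟨c, hc, by rw [hder c hc]; linarith [e]⟩

/-- The composite midpoint rule, with derivative corrections at the endpoints. -/
theorem composite_midpoint_bounds {g : ℝ → ℝ} (hg : ContDiff ℝ 4 g) {a b m M h : ℝ} {n : ℕ}
    (hh : 0 < h) (hnh : a + n * h = b)
    (hb : ∀ t ∈ Set.Icc a b, m ≤ iteratedDeriv 4 g t ∧ iteratedDeriv 4 g t ≤ M) :
    n * (23 / 5760 * h ^ 5 * m) ≤ (∫ x in a..b, g x)
        - h * ∑ k ∈ Finset.range n, g (a + (1 / 2 + k) * h)
        - h ^ 2 / 24 * (iteratedDeriv 1 g b - iteratedDeriv 1 g a)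
        + h ^ 4 / 192 * (iteratedDeriv 3 g b - iteratedDeriv 3 g a) ∧
    (∫ x in a..b, g x) - h * ∑ k ∈ Finset.range n, g (a + (1 / 2 + k) * h)
        - h ^ 2 / 24 * (iteratedDeriv 1 g b - iteratedDeriv 1 g a)
        + h ^ 4 / 192 * (iteratedDeriv 3 g b - iteratedDeriv 3 g a)
      ≤ n * (23 / 5760 * h ^ 5 * M) := by
  have hcell : ∀ k ∈ Finset.range n,
      23 / 5760 * h ^ 5 * m ≤ (∫ x in (a + k * h)..(a + ((k + 1 : ℕ) : ℝ) * h), g x)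
        - h * g (a + (1 / 2 + k) * h)
        - h ^ 2 / 24 * (iteratedDeriv 1 g (a + ((k + 1 : ℕ) : ℝ) * h)
          - iteratedDeriv 1 g (a + k * h))
        + h ^ 4 / 192 * (iteratedDeriv 3 g (a + ((k + 1 : ℕ) : ℝ) * h)
          - iteratedDeriv 3 g (a + k * h)) ∧
      (∫ x in (a + k * h)..(a + ((k + 1 : ℕ) : ℝ) * h), g x)
        - h * g (a + (1 / 2 + k) * h)
        - h ^ 2 / 24 * (iteratedDeriv 1 g (a + ((k + 1 : ℕ) : ℝ) * h)
          - iteratedDeriv 1 g (a + k * h))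
        + h ^ 4 / 192 * (iteratedDeriv 3 g (a + ((k + 1 : ℕ) : ℝ) * h)
          - iteratedDeriv 3 g (a + k * h)) ≤ 23 / 5760 * h ^ 5 * M := by
    intro k hk
    have hk1 : (k : ℝ) + 1 ≤ n := by exact_mod_cast Finset.mem_range.1 hk
    have hk0 : (0 : ℝ) ≤ k := Nat.cast_nonneg k
    have hkh : (k : ℝ) * h + h ≤ n * h := by nlinarith
    have hkh0 : 0 ≤ (k : ℝ) * h := by positivity
    have h1 := midpoint_bounds hg (c := a + (1 / 2 + k) * h) hh (m := m) (M := M)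
      fun t ht => hb t ⟨by linarith [ht.1], by linarith [ht.2]⟩
    rw [show a + (1 / 2 + k) * h - h / 2 = a + k * h by ring,
      show a + (1 / 2 + k) * h + h / 2 = a + ((k + 1 : ℕ) : ℝ) * h by push_cast; ring] at h1
    exact h1
  have hlow := Finset.sum_le_sum fun k hk => (hcell k hk).1
  have hupp := Finset.sum_le_sum fun k hk => (hcell k hk).2
  have hint := intervalIntegral.sum_integral_adjacent_intervals (μ := volume) (f := g)
    (a := fun k : ℕ => a + k * h) (n := n) fun k _ => hg.continuous.intervalIntegrable _ _
  -- The derivative corrections of neighbouring cells telescope, so only those at `a` and `b`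
  -- remain.
  have ht₁ := Finset.sum_range_sub (fun k : ℕ => iteratedDeriv 1 g (a + k * h)) n
  have ht₃ := Finset.sum_range_sub (fun k : ℕ => iteratedDeriv 3 g (a + k * h)) n
  simp only [Finset.sum_const, Finset.card_range, nsmul_eq_mul, Finset.sum_sub_distrib,
    Finset.sum_add_distrib, ← Finset.mul_sum] at hlow hupp hint ht₁ ht₃
  rw [hint, ht₁, ht₃] at hlow hupp
  rw [Nat.cast_zero, zero_mul, add_zero, hnh] at hlow hupp
  exact ⟨hlow, hupp⟩

/-- The error is the corrected midpoint error minus the two boundary corrections. The terms in `g'`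
and `g'''` cancel between them, and each part lies between sharp bounds of its own, which gives one
intermediate point for each. -/
theorem I2_error_formula {a b : ℝ} (hab : a < b) {f : ℝ → ℝ}
    (hf : ContDiffOn ℝ 4 f (Set.Icc a b)) {n : ℕ} (hn : 4 ≤ n) :
    ∃ c ∈ Set.Icc a b, ∃ c' ∈ Set.Icc a b,
      (∫ x in a..b, f x) - I2 a b n f =
        23 / 5760 * (b - a) * mesh a b n ^ 4 * iteratedDerivWithin 4 f (Set.Icc a b) c
        - 1 / 192 * mesh a b n ^ 5 * iteratedDerivWithin 4 f (Set.Icc a b) c' := by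
  obtain ⟨r, rfl⟩ : ∃ r, n = r + 4 := ⟨n - 4, by omega⟩
  obtain ⟨g, hg, hfg, hder⟩ := exists_extension_four hab hf
  have hDc : Continuous (iteratedDeriv 4 g) := hg.continuous_iteratedDeriv 4 le_rfl
  obtain ⟨m, M, hb, hsharp⟩ := exists_sharp_bounds hab hDc
  obtain ⟨F, hF⟩ : ∃ F : ℝ → ℝ, ∀ t, F t = f (a + t * mesh a b (r + 4)) := ⟨_, fun _ => rfl⟩
  have hnh := add_mul_mesh a b (n := r + 4) (by omega)
  have hh := mesh_pos hab (n := r + 4) (by omega)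
  rw [I2_eq_sum hab f r hF]
  set h := mesh a b (r + 4) with hh'
  have hr : (0 : ℝ) ≤ r * h := by positivity
  push_cast at hnh
  have hFg : ∀ t : ℝ, 0 ≤ t → t ≤ r + 4 → F t = g (a + t * h) := fun t h0 h1 => by
    rw [hF, hfg ⟨by nlinarith, by nlinarith⟩]
  obtain ⟨hlow, hupp⟩ := composite_midpoint_bounds hg (n := r + 4) hh
    (by push_cast; exact hnh) hb
  have hFk : ∑ k ∈ Finset.range (r + 4), g (a + (1 / 2 + k) * h)
      = ∑ k ∈ Finset.range (r + 4), F (1 / 2 + k) := by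
    refine Finset.sum_congr rfl fun k hk => ?_
    have hk1 : (k : ℝ) + 1 ≤ r + 4 := by exact_mod_cast Finset.mem_range.1 hk
    rw [hFg _ (by positivity) (by linarith)]
  have hsum : ∑ k ∈ Finset.range (r + 4), F (1 / 2 + k)
      = ∑ k ∈ Finset.range r, F (5 / 2 + k)
        + (F (1 / 2) + F (3 / 2) + F (r + 5 / 2) + F (r + 7 / 2)) := by
    rw [show r + 4 = 2 + r + 1 + 1 by ring, Finset.sum_range_succ, Finset.sum_range_succ,
      Finset.sum_range_add]
    simp only [Finset.sum_range_succ, Finset.sum_range_zero]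
    push_cast
    ring_nf
  have hfi : ∫ x in a..b, f x = ∫ x in a..b, g x :=
    intervalIntegral.integral_congr (by rwa [Set.uIcc_of_le hab.le])
  rw [hFk, hsum, ← hfi] at hlow hupp
  push_cast at hlow hupp
  have bl := boundary_bounds_affine hg (c := a) (h := h) (m := m) (M := M) fun u hu =>
    hb _ ⟨by nlinarith [hu.1], by nlinarith [hu.2]⟩
  -- At the right end the scale is `-h`, so `g'` and `g'''` at `b` enter with the sign opposite to
  -- that at `a`, as in the differences left by the midpoint rule.
  have br := boundary_bounds_affine hg (c := b) (h := -h) (m := m) (M := M) fun u hu =>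
    hb _ ⟨by nlinarith [hu.2], by nlinarith [hu.1]⟩
  have v₀ : g a = F 0 := by rw [hFg 0 le_rfl (by positivity), zero_mul, add_zero]
  have v₁ : g (a + h * (1 / 2)) = F (1 / 2) := by
    rw [hFg _ (by norm_num) (by linarith [Nat.cast_nonneg (α := ℝ) r]), mul_comm]
  have v₂ : g (a + h * (3 / 2)) = F (3 / 2) := by
    rw [hFg _ (by norm_num) (by linarith [Nat.cast_nonneg (α := ℝ) r]), mul_comm]
  have w₀ : g b = F (r + 4) := by rw [hFg _ (by positivity) le_rfl, hnh]
  have w₁ : g (b + -h * (1 / 2)) = F (r + 7 / 2) := by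
    rw [hFg _ (by positivity) (by linarith), ← hnh]
    congr 1
    ring
  have w₂ : g (b + -h * (3 / 2)) = F (r + 5 / 2) := by
    rw [hFg _ (by positivity) (by linarith), ← hnh]
    congr 1
    ring
  rw [v₀, v₁, v₂] at bl
  rw [w₀, w₁, w₂] at br
  have bl₁ := mul_le_mul_of_nonneg_left bl.1 hh.le
  have bl₂ := mul_le_mul_of_nonneg_left bl.2 hh.le
  have br₁ := mul_le_mul_of_nonneg_left br.1 hh.le
  have br₂ := mul_le_mul_of_nonneg_left br.2 hh.le
  have hA : ((r : ℝ) + 4) * (23 / 5760 * h ^ 5) = 23 / 5760 * (b - a) * h ^ 4 := by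
    linear_combination 23 / 5760 * h ^ 4 * hnh
  obtain ⟨c, hc, e⟩ := hsharp (23 / 5760 * (b - a) * h ^ 4)
    ((∫ x in a..b, f x)
      - h * (∑ k ∈ Finset.range r, F (5 / 2 + k)
        + (F (1 / 2) + F (3 / 2) + F (r + 5 / 2) + F (r + 7 / 2)))
      - h ^ 2 / 24 * (iteratedDeriv 1 g b - iteratedDeriv 1 g a)
      + h ^ 4 / 192 * (iteratedDeriv 3 g b - iteratedDeriv 3 g a)) (mul_pos (mul_pos (by norm_num) (by linarith)) (by positivity))
    (by rw [← hA]; linarith [hlow])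
    (by rw [← hA]; linarith [hupp])
  -- Each end contributes `1 / 384`, and the two are added before the intermediate value theorem is
  -- applied.
  obtain ⟨c', hc', e'⟩ := hsharp (1 / 192 * h ^ 5)
    (h * (1 / 9 * F 0 - 1 / 8 * F (1 / 2) + 1 / 72 * F (3 / 2) + h * iteratedDeriv 1 g a / 24
        - h ^ 3 * iteratedDeriv 3 g a / 192)
      + h * (1 / 9 * F (r + 4) - 1 / 8 * F (r + 7 / 2) + 1 / 72 * F (r + 5 / 2)
        + -h * iteratedDeriv 1 g b / 24 - (-h) ^ 3 * iteratedDeriv 3 g b / 192))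
    (by positivity) (by linarith) (by linarith)
  refine ⟨c, hc, c', hc', ?_⟩
  rw [hder c hc, hder c' hc', ← e, ← e']
  ring

/-! ### The quadrature rules in their original indexing -/

theorem I2_rule {a b : ℝ} (hab : a < b) (f : ℝ → ℝ) (n : ℕ) (hn : 4 ≤ n) :
    I2 a b n f =
      mesh a b n * ∑ j ∈ Finset.Icc (4 : ℤ) (n - 1), f (midpt a b n j)
      + mesh a b n *
        (1 / 9 * (f (midpt a b n 1) + f (midpt a b n (n + 2)))
          + 7 / 8 * (f (midpt a b n 2) + f (midpt a b n (n + 1)))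
          + 73 / 72 * (f (midpt a b n 3) + f (midpt a b n n))) := by
  obtain ⟨m, rfl⟩ : ∃ m, n = m + 4 := ⟨n - 4, by omega⟩
  rw [I2_eq hab, show ((m + 4 : ℕ) : ℤ) - 1 = 4 + m - 1 by push_cast; ring,
    sum_Icc_int_eq_sum_range, mul_add]
  push_cast
  ring_nf

theorem I3_rule {a b : ℝ} (hab : a < b) (f : ℝ → ℝ) (n : ℕ) (hn : 7 ≤ n) :
    I3 a b n f =
      mesh a b n * ∑ j ∈ Finset.Icc (4 : ℤ) (n - 4), f (knot a b n j)
      + mesh a b n *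
        (23 / 72 * (f (knot a b n 0) + f (knot a b n n))
          + 4 / 3 * (f (knot a b n 1) + f (knot a b n (n - 1)))
          + 19 / 24 * (f (knot a b n 2) + f (knot a b n (n - 2)))
          + 19 / 18 * (f (knot a b n 3) + f (knot a b n (n - 3)))) := by
  obtain ⟨m, rfl⟩ : ∃ m, n = m + 7 := ⟨n - 7, by omega⟩
  rw [I3_eq hab, show ((m + 7 : ℕ) : ℤ) - 4 = 4 + m - 1 by push_cast; ring,
    sum_Icc_int_eq_sum_range, mul_add]
  push_cast
  ring_nf

theorem I4_rule {a b : ℝ} (hab : a < b) (f : ℝ → ℝ) (n : ℕ) (hn : 8 ≤ n) :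
    I4 a b n f =
      mesh a b n * ∑ j ∈ Finset.Icc (6 : ℤ) (n - 3), f (midpt a b n j)
      + mesh a b n *
        (206 / 1575 * (f (midpt a b n 1) + f (midpt a b n (n + 2)))
          + 107 / 128 * (f (midpt a b n 2) + f (midpt a b n (n + 1)))
          + 6019 / 5760 * (f (midpt a b n 3) + f (midpt a b n n)))
      + mesh a b n *
        (9467 / 9600 * (f (midpt a b n 4) + f (midpt a b n (n - 1)))
          + 13469 / 13440 * (f (midpt a b n 5) + f (midpt a b n (n - 2)))) := by
  obtain ⟨m, rfl⟩ : ∃ m, n = m + 8 := ⟨n - 8, by omega⟩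
  rw [I4_eq hab, show ((m + 8 : ℕ) : ℤ) - 3 = 6 + m - 1 by push_cast; ring,
    sum_Icc_int_eq_sum_range]
  push_cast
  ring_nf

theorem I5_rule {a b : ℝ} (hab : a < b) (f : ℝ → ℝ) (n : ℕ) (hn : 11 ≤ n) :
    I5 a b n f =
      mesh a b n * ∑ j ∈ Finset.Icc (6 : ℤ) (n - 6), f (knot a b n j)
      + mesh a b n *
        (157 / 480 * (f (knot a b n 0) + f (knot a b n n))
          + 961 / 720 * (f (knot a b n 1) + f (knot a b n (n - 1)))
          + 133 / 180 * (f (knot a b n 2) + f (knot a b n (n - 2))))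
      + mesh a b n *
        (271 / 240 * (f (knot a b n 3) + f (knot a b n (n - 3)))
          + 1393 / 1440 * (f (knot a b n 4) + f (knot a b n (n - 4)))
          + 361 / 360 * (f (knot a b n 5) + f (knot a b n (n - 5)))) := by
  obtain ⟨m, rfl⟩ : ∃ m, n = m + 11 := ⟨n - 11, by omega⟩
  rw [I5_eq hab, show ((m + 11 : ℕ) : ℤ) - 6 = 6 + m - 1 by push_cast; ring,
    sum_Icc_int_eq_sum_range]
  push_cast
  ring_nf

end SplineQI

end

open SplineQI in
theorem mainTheorem6 (a b : ℝ) (hab : a < b) :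
    -- the four composite quadrature rules obtained by integrating the quasi-interpolants
    (∀ (f : ℝ → ℝ) (n : ℕ), 4 ≤ n →
      IntervalIntegrable (Q2 a b n f) MeasureTheory.volume a b ∧
      I2 a b n f =
        mesh a b n * ∑ j ∈ Finset.Icc (4 : ℤ) (n - 1), f (midpt a b n j)
        + mesh a b n *
          (1 / 9 * (f (midpt a b n 1) + f (midpt a b n (n + 2)))
            + 7 / 8 * (f (midpt a b n 2) + f (midpt a b n (n + 1)))
            + 73 / 72 * (f (midpt a b n 3) + f (midpt a b n n)))) ∧
    (∀ (f : ℝ → ℝ) (n : ℕ), 7 ≤ n →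
      IntervalIntegrable (Q3 a b n f) MeasureTheory.volume a b ∧
      I3 a b n f =
        mesh a b n * ∑ j ∈ Finset.Icc (4 : ℤ) (n - 4), f (knot a b n j)
        + mesh a b n *
          (23 / 72 * (f (knot a b n 0) + f (knot a b n n))
            + 4 / 3 * (f (knot a b n 1) + f (knot a b n (n - 1)))
            + 19 / 24 * (f (knot a b n 2) + f (knot a b n (n - 2)))
            + 19 / 18 * (f (knot a b n 3) + f (knot a b n (n - 3))))) ∧
    (∀ (f : ℝ → ℝ) (n : ℕ), 8 ≤ n →
      IntervalIntegrable (Q4 a b n f) MeasureTheory.volume a b ∧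
      I4 a b n f =
        mesh a b n * ∑ j ∈ Finset.Icc (6 : ℤ) (n - 3), f (midpt a b n j)
        + mesh a b n *
          (206 / 1575 * (f (midpt a b n 1) + f (midpt a b n (n + 2)))
            + 107 / 128 * (f (midpt a b n 2) + f (midpt a b n (n + 1)))
            + 6019 / 5760 * (f (midpt a b n 3) + f (midpt a b n n)))
        + mesh a b n *
          (9467 / 9600 * (f (midpt a b n 4) + f (midpt a b n (n - 1)))
            + 13469 / 13440 * (f (midpt a b n 5) + f (midpt a b n (n - 2))))) ∧
    (∀ (f : ℝ → ℝ) (n : ℕ), 11 ≤ n →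
      IntervalIntegrable (Q5 a b n f) MeasureTheory.volume a b ∧
      I5 a b n f =
        mesh a b n * ∑ j ∈ Finset.Icc (6 : ℤ) (n - 6), f (knot a b n j)
        + mesh a b n *
          (157 / 480 * (f (knot a b n 0) + f (knot a b n n))
            + 961 / 720 * (f (knot a b n 1) + f (knot a b n (n - 1)))
            + 133 / 180 * (f (knot a b n 2) + f (knot a b n (n - 2))))
        + mesh a b n *
          (271 / 240 * (f (knot a b n 3) + f (knot a b n (n - 3)))
            + 1393 / 1440 * (f (knot a b n 4) + f (knot a b n (n - 4)))
            + 361 / 360 * (f (knot a b n 5) + f (knot a b n (n - 5))))) ∧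
    -- the errors are `O(h^(d+1))` for functions of class `C^(d+1)`
    (∀ f : ℝ → ℝ, ContDiffOn ℝ 3 f (Set.Icc a b) → ∃ C : ℝ, ∀ n : ℕ, 4 ≤ n →
      |(∫ x in a..b, f x) - I2 a b n f| ≤ C * mesh a b n ^ 3) ∧
    (∀ f : ℝ → ℝ, ContDiffOn ℝ 4 f (Set.Icc a b) → ∃ C : ℝ, ∀ n : ℕ, 7 ≤ n →
      |(∫ x in a..b, f x) - I3 a b n f| ≤ C * mesh a b n ^ 4) ∧
    (∀ f : ℝ → ℝ, ContDiffOn ℝ 5 f (Set.Icc a b) → ∃ C : ℝ, ∀ n : ℕ, 8 ≤ n →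
      |(∫ x in a..b, f x) - I4 a b n f| ≤ C * mesh a b n ^ 5) ∧
    (∀ f : ℝ → ℝ, ContDiffOn ℝ 6 f (Set.Icc a b) → ∃ C : ℝ, ∀ n : ℕ, 11 ≤ n →
      |(∫ x in a..b, f x) - I5 a b n f| ≤ C * mesh a b n ^ 6) ∧
    -- the error formula for the quadratic rule
    (∀ f : ℝ → ℝ, ContDiffOn ℝ 4 f (Set.Icc a b) → ∀ n : ℕ, 4 ≤ n →
      ∃ c ∈ Set.Icc a b, ∃ c' ∈ Set.Icc a b,
        (∫ x in a..b, f x) - I2 a b n f =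
          23 / 5760 * (b - a) * mesh a b n ^ 4 * iteratedDerivWithin 4 f (Set.Icc a b) c
          - 1 / 192 * mesh a b n ^ 5 * iteratedDerivWithin 4 f (Set.Icc a b) c') ∧
    -- the higher order of the quartic rule
    (∀ f : ℝ → ℝ, ContDiffOn ℝ 6 f (Set.Icc a b) → ∃ C : ℝ, ∀ n : ℕ, 8 ≤ n →
      |(∫ x in a..b, f x) - I4 a b n f| ≤ C * mesh a b n ^ 6) ∧
    -- the error formula for Simpson's rule
    (∀ f : ℝ → ℝ, ContDiffOn ℝ 4 f (Set.Icc a b) → ∀ n : ℕ, 2 ≤ n → Even n →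
      ∃ c ∈ Set.Icc a b,
        (∫ x in a..b, f x) - simpson a b n f =
          -(1 / 180) * (b - a) * mesh a b n ^ 4 * iteratedDerivWithin 4 f (Set.Icc a b) c) ∧
    -- the extrapolated rule
    (∀ f : ℝ → ℝ, ContDiffOn ℝ 5 f (Set.Icc a b) → ∃ C : ℝ, ∀ n : ℕ, 4 ≤ n → Even n →
      |(∫ x in a..b, f x) - 1 / 55 * (32 * I2 a b n f + 23 * simpson a b n f)|
        ≤ C * mesh a b n ^ 5) := by
  refine ⟨fun f n hn => ⟨spline_intervalIntegrable n 2 _, I2_rule hab f n hn⟩,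
    fun f n hn => ⟨spline_intervalIntegrable n 3 _, I3_rule hab f n hn⟩,
    fun f n hn => ⟨spline_intervalIntegrable n 4 _, I4_rule hab f n hn⟩,
    fun f n hn => ⟨spline_intervalIntegrable n 5 _, I5_rule hab f n hn⟩,
    fun f hf => exists_I2_error_bound hab hf,
    fun f hf => exists_I3_error_bound hab hf,
    fun f hf => exists_I4_error_bound hab hf,
    fun f hf => exists_I5_error_bound hab hf,
    fun f hf n hn => I2_error_formula hab hf hn,
    fun f hf => exists_I4_error_bound_of_contDiffOn_six hab hf,
    fun f hf n hn he => simpson_error_formula hab hf hn he,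
    fun f hf => exists_extrapolation_error_bound hab hf⟩
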